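/- Let $n\ge 0$ be an integer and let $E_{i,j}$, $i,j\in\{1,\dots,n,-1,\dots,-n\}$, be the matrix units of the general linear Lie superalgebra $\mathfrak{gl}(n|n)$ over $\mathbb Q$, where $E_{i,j}$ is even if $ij>0$ and odd if $ij<0$, and $[X,Y]=XY-(-1)^{|X||Y|}YX$ for homogeneous $X,Y$. The queer Lie superalgebra $\mathfrak q(n)\subseteq\mathfrak{gl}(n|n)$ consists of the matrices $\begin{pmatrix}A&B\\ B&A\end{pmatrix}$ with $A,B$ arbitrary $n\times n$ matrices over $\mathbb Q$. Let $U=U(\mathfrak q(n))$ be its universal enveloping superalgebra over $\mathbb Q$, i.e. the quotient of the tensor algebra of $\mathfrak q(n)$ by the relations $u\otimes v-(-1)^{|u||v|}v\otimes u=[u,v]$ for homogeneous $u,v$. In $U$ put, for $1\le i\ne j\le n$, $$x_{i,j}=E_{i,j}+E_{-i,-j},\qquad \bar x_{i,j}=E_{i,-j}+E_{-i,j},$$ for $1\le i\le n$, $$h_i=E_{i,i}+E_{-i,-i},\qquad h_{\bar i}=E_{i,-i}+E_{-i,i},$$ and, for $1\le i\le n-1$, $e_i=x_{i,i+1}$,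 $e_{\bar i}=\bar x_{i,i+1}$, $f_i=x_{i+1,i}$, $f_{\bar i}=\bar x_{i+1,i}$. For $k\in\mathbb N=\{0,1,2,\dots\}$ and $u\in U$ write $u^{(k)}=u^k/k!$ and $\binom{h_i}{k}=h_i(h_i-1)\cdots(h_i-k+1)/k!$ (so $\binom{h_i}{0}=1$). Let $U_{\mathbb Z}^+$, $U_{\mathbb Z}^-$, $U_{\mathbb Z}^0$ be the $\mathbb Z$-subalgebras of $U$ generated, respectively, by all $e_i^{(k)},e_{\bar i}$; by all $f_i^{(k)},f_{\bar i}$ ($1\le i\le n-1$, $k\in\mathbb N$); and by all $\binom{h_i}{k},h_{\bar i}$ ($1\le i\le n$, $k\in\mathbb N$). Let $U_{\mathbb Z}$, the Kostant $\mathbb Z$-form, be the $\mathbb Z$-subalgebra of $U$ generated by all of these elements together. Let $M_n(\mathbb N|\mathbb Z_2)$ be the set of pairs $A=(A_0,A_1)$ of $n\times n$ matrices, $A_0=(a^0_{ij})$ with entries in $\mathbb N$ and $A_1=(a^1_{ij})$ with entries in $\{0,1\}$. For such $A$ put $y_{i,j}=x_{i,j}^{(a^0_{ij})}\,\bar x_{i,j}^{\,a^1_{ij}}$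 for $i\neq j$, and $$e_{A^+}=\pi^+_{n-1}\cdots\pi^+_1,\quad \pi^+_j=y_{j,j+1}\,y_{j,j+2}\cdots y_{j,n},\qquad f_{A^-}=\pi^-_1\cdots\pi^-_{n-1},\quad \pi^-_j=y_{n,j}\,y_{n-1,j}\cdots y_{j+1,j},$$ $$\binom{\boldsymbol h}{A_0^0}=\prod_{i=1}^n\binom{h_i}{a^0_{ii}},\qquad \overline h_{A_1^0}=h_{\bar 1}^{a^1_{11}}\cdots h_{\bar n}^{a^1_{nn}}.$$ Then: 1. Multiplication $a\otimes b\otimes c\mapsto abc$ is an isomorphism of abelian groups $U_{\mathbb Z}^-\otimes_{\mathbb Z}U_{\mathbb Z}^0\otimes_{\mathbb Z}U_{\mathbb Z}^+\xrightarrow{\ \sim\ }U_{\mathbb Z}$. 2. $U_{\mathbb Z}$ is a free $\mathbb Z$-module with basis the family $$f_{A^-}\binom{\boldsymbol h}{A_0^0}\,\overline h_{A_1^0}\,e_{A^+},\qquad A\in M_n(\mathbb N|\mathbb Z_2).$$ -/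

import Mathlib

open scoped TensorProduct

namespace Queer

/-- The index set `I(n|n) = {1, …, n, -1, …, -n}`: `Sum.inl i` stands for the positive index `i`
and `Sum.inr i` for the negative index `-i`. -/
abbrev Idx (n : ℕ) : Type := Fin n ⊕ Fin n

/-- The sign of an index as an element of `ℤ/2`: `0` for positive, `1` for negative indices. -/
def idxParity {n : ℕ} : Idx n → ZMod 2 := Sum.elim (fun _ => 0) (fun _ => 1)

/-- Matrices of size `(n|n)` over `ℚ`, the underlying space of `𝔤𝔩(n|n)`. -/
abbrev SMat (n : ℕ) : Type := Matrix (Idx n) (Idx n) ℚ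

/-- The homogeneous component of parity `p` of a matrix of `𝔤𝔩(n|n)`; the matrix unit `E_{i,j}` has
parity `idxParity i + idxParity j`. -/
def component {n : ℕ} (p : ZMod 2) (X : SMat n) : SMat n :=
  fun i j => if idxParity i + idxParity j = p then X i j else 0

/-- The Lie superbracket of `𝔤𝔩(n|n)`: the bilinear extension of
`[X, Y] = X Y - (-1)^{p q} Y X` for `X` of parity `p` and `Y` of parity `q`. -/
def bracket {n : ℕ} (X Y : SMat n) : SMat n :=
  ∑ p : ZMod 2, ∑ q : ZMod 2,
    (component p X * component q Y
      - (-1 : ℚ) ^ (p.val * q.val) • (component q Y * component p X))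

theorem component_fromBlocks_zero {n : ℕ} (A B C D : Matrix (Fin n) (Fin n) ℚ) :
    component 0 (Matrix.fromBlocks A B C D) = Matrix.fromBlocks A 0 0 D := by
  have e : (1 + 1 : ZMod 2) = 0 := by decide
  ext (i | i) (j | j) <;> simp [component, idxParity, e]

theorem component_fromBlocks_one {n : ℕ} (A B C D : Matrix (Fin n) (Fin n) ℚ) :
    component 1 (Matrix.fromBlocks A B C D) = Matrix.fromBlocks 0 B C 0 := by
  have e : (1 + 1 : ZMod 2) = 0 := by decide
  ext (i | i) (j | j) <;> simp [component, idxParity, e]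

theorem bracket_eq {n : ℕ} (X Y : SMat n) :
    bracket X Y =
      (component 0 X * component 0 Y - component 0 Y * component 0 X)
      + (component 0 X * component 1 Y - component 1 Y * component 0 X)
      + ((component 1 X * component 0 Y - component 0 Y * component 1 X)
      + (component 1 X * component 1 Y + component 1 Y * component 1 X)) := by
  have h (f : ZMod 2 → SMat n) : ∑ p, f p = f 0 + f 1 := Fin.sum_univ_two f
  simp [bracket, h, ZMod.val_one]

/-- The underlying space of the queer Lie superalgebra `𝔮(n)`: the matrices of `𝔤𝔩(n|n)` with
block form `(A B; B A)`. -/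
def q (n : ℕ) : Submodule ℚ (SMat n) where
  carrier := {X | ∃ A B : Matrix (Fin n) (Fin n) ℚ, X = Matrix.fromBlocks A B B A}
  zero_mem' := ⟨0, 0, by simp⟩
  add_mem' := by
    rintro _ _ ⟨A, B, rfl⟩ ⟨C, D, rfl⟩
    exact ⟨A + C, B + D, by rw [Matrix.fromBlocks_add]⟩
  smul_mem' := by
    rintro c _ ⟨A, B, rfl⟩
    exact ⟨c • A, c • B, by rw [Matrix.fromBlocks_smul]⟩

theorem bracket_mem_q {n : ℕ} {X Y : SMat n} (hX : X ∈ q n) (hY : Y ∈ q n) :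
    bracket X Y ∈ q n := by
  obtain ⟨A, B, rfl⟩ := hX
  obtain ⟨C, D, rfl⟩ := hY
  rw [bracket_eq]
  simp only [component_fromBlocks_zero, component_fromBlocks_one, Matrix.fromBlocks_multiply,
    sub_eq_add_neg, Matrix.fromBlocks_neg, Matrix.fromBlocks_add]
  refine ⟨(A * C - C * A) + (B * D + D * B), (A * D - D * A) + (B * C - C * B), ?_⟩
  congr 1 <;> simp <;> abel

/-- The Lie superbracket of `𝔮(n)`. -/
def qBracket {n : ℕ} (u v : q n) : q n := ⟨bracket u.1 v.1, bracket_mem_q u.2 v.2⟩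

/-- `u ∈ 𝔮(n)` is homogeneous of parity `p`. -/
def IsHomogeneous {n : ℕ} (p : ZMod 2) (u : q n) : Prop := component p u.1 = u.1

/-- The defining relations of the enveloping superalgebra:
`u ⊗ v = [u, v] + (-1)^{p p'} v ⊗ u` for homogeneous `u`, `v` of parities `p`, `p'`. -/
inductive Rel (n : ℕ) : TensorAlgebra ℚ (q n) → TensorAlgebra ℚ (q n) → Prop
  | comm (p p' : ZMod 2) (u v : q n) (hu : IsHomogeneous p u) (hv : IsHomogeneous p' v) :
      Rel n (TensorAlgebra.ι ℚ u * TensorAlgebra.ι ℚ v)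
        (TensorAlgebra.ι ℚ (qBracket u v)
          + (-1 : ℚ) ^ (p.val * p'.val) • (TensorAlgebra.ι ℚ v * TensorAlgebra.ι ℚ u))

/-- The universal enveloping superalgebra `U(𝔮(n))` over `ℚ`. -/
def U (n : ℕ) : Type := RingQuot (Rel n)

noncomputable section

instance (n : ℕ) : Ring (U n) := inferInstanceAs (Ring (RingQuot (Rel n)))

instance (n : ℕ) : Algebra ℚ (U n) := inferInstanceAs (Algebra ℚ (RingQuot (Rel n)))

/-- The canonical linear map `𝔮(n) → U(𝔮(n))`. -/
def toU (n : ℕ) : q n →ₗ[ℚ] U n :=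
  (RingQuot.mkAlgHom ℚ (Rel n)).toLinearMap ∘ₗ TensorAlgebra.ι ℚ

/-- The even element `E_{i,j} + E_{-i,-j}` of `𝔮(n)`. -/
def evenUnit {n : ℕ} (i j : Fin n) : q n :=
  ⟨Matrix.single (Sum.inl i) (Sum.inl j) 1 + Matrix.single (Sum.inr i) (Sum.inr j) 1,
    Matrix.single i j 1, 0, by
      ext (a | a) (b | b) <;> simp [Matrix.single_apply]⟩

/-- The odd element `E_{i,-j} + E_{-i,j}` of `𝔮(n)`. -/
def oddUnit {n : ℕ} (i j : Fin n) : q n :=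
  ⟨Matrix.single (Sum.inl i) (Sum.inr j) 1 + Matrix.single (Sum.inr i) (Sum.inl j) 1,
    0, Matrix.single i j 1, by
      ext (a | a) (b | b) <;> simp [Matrix.single_apply]⟩

/-- The even root vector `x_{i,j}` (for `i ≠ j`) in `U(𝔮(n))`. -/
def x {n : ℕ} (i j : Fin n) : U n := toU n (evenUnit i j)

/-- The odd root vector `x̄_{i,j}` (for `i ≠ j`) in `U(𝔮(n))`. -/
def xbar {n : ℕ} (i j : Fin n) : U n := toU n (oddUnit i j)

/-- The even Cartan element `h_i = E_{i,i} + E_{-i,-i}`. -/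
def h {n : ℕ} (i : Fin n) : U n := toU n (evenUnit i i)

/-- The odd Cartan element `h_{\bar i} = E_{i,-i} + E_{-i,i}`. -/
def hbar {n : ℕ} (i : Fin n) : U n := toU n (oddUnit i i)

/-- The divided power `u^{(k)} = u^k / k!`. -/
def divPow {n : ℕ} (u : U n) (k : ℕ) : U n := ((k.factorial : ℚ)⁻¹) • u ^ k

/-- The binomial `u (u - 1) ⋯ (u - k + 1) / k!`. -/
def binom {n : ℕ} (u : U n) (k : ℕ) : U n :=
  ((k.factorial : ℚ)⁻¹) • ((List.range k).map fun t : ℕ => u - (t : U n)).prod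

/-- The generators `e_i^{(k)} = x_{i,i+1}^{(k)}` and `e_{\bar i} = x̄_{i,i+1}`. -/
def plusGens (n : ℕ) : Set (U n) :=
  {u | ∃ i j : Fin n, (j : ℕ) = i + 1 ∧ ((∃ k : ℕ, u = divPow (x i j) k) ∨ u = xbar i j)}

/-- The generators `f_i^{(k)} = x_{i+1,i}^{(k)}` and `f_{\bar i} = x̄_{i+1,i}`. -/
def minusGens (n : ℕ) : Set (U n) :=
  {u | ∃ i j : Fin n, (j : ℕ) = i + 1 ∧ ((∃ k : ℕ, u = divPow (x j i) k) ∨ u = xbar j i)}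

/-- The generators `binom(h_i, k)` and `h_{\bar i}`. -/
def zeroGens (n : ℕ) : Set (U n) :=
  {u | ∃ i : Fin n, (∃ k : ℕ, u = binom (h i) k) ∨ u = hbar i}

/-- The subalgebra `U_ℤ^+`. -/
def UZplus (n : ℕ) : Subalgebra ℤ (U n) := Algebra.adjoin ℤ (plusGens n)

/-- The subalgebra `U_ℤ^-`. -/
def UZminus (n : ℕ) : Subalgebra ℤ (U n) := Algebra.adjoin ℤ (minusGens n)

/-- The subalgebra `U_ℤ^0`. -/
def UZzero (n : ℕ) : Subalgebra ℤ (U n) := Algebra.adjoin ℤ (zeroGens n)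

/-- The Kostant `ℤ`-form `U_ℤ`. -/
def UZ (n : ℕ) : Subalgebra ℤ (U n) :=
  Algebra.adjoin ℤ (plusGens n ∪ minusGens n ∪ zeroGens n)

/-- The index set `M_n(ℕ|ℤ₂) = M_n(ℕ) × M_n(ℤ₂)`, with `ℤ₂ = {0, 1}` seen inside `ℕ`. -/
abbrev SuperMat (n : ℕ) : Type := Matrix (Fin n) (Fin n) ℕ × Matrix (Fin n) (Fin n) (Fin 2)

/-- The factor `x_{i,j}^{(a⁰_{ij})} x̄_{i,j}^{a¹_{ij}}`. -/
def rootFactor {n : ℕ} (A : SuperMat n) (i j : Fin n) : U n :=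
  divPow (x i j) (A.1 i j) * xbar i j ^ (A.2 i j : ℕ)

/-- `π_j(A^+)`: the ordered product of the root factors of row `j`, from column `j + 1` to
column `n`. -/
def rowProd {n : ℕ} (A : SuperMat n) (j : Fin n) : U n :=
  (((List.finRange n).filter fun k => j < k).map fun k => rootFactor A j k).prod

/-- `e_{A^+} = π_{n-1}(A^+) ⋯ π_1(A^+)` (the empty row product `π_n(A^+)` is `1`). -/
def ePlus {n : ℕ} (A : SuperMat n) : U n :=
  ((List.finRange n).reverse.map fun j => rowProd A j).prod

/-- `π_j(A^-)`: the ordered product of the root factors of column `j`, from row `n` up to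
row `j + 1`. -/
def colProd {n : ℕ} (A : SuperMat n) (j : Fin n) : U n :=
  (((List.finRange n).filter fun k => j < k).reverse.map fun k => rootFactor A k j).prod

/-- `f_{A^-} = π_1(A^-) ⋯ π_{n-1}(A^-)` (the empty column product `π_n(A^-)` is `1`). -/
def fMinus {n : ℕ} (A : SuperMat n) : U n :=
  ((List.finRange n).map fun j => colProd A j).prod

/-- `binom(h, b) = ∏ i, binom(h_i, b_i)`. -/
def hBinom {n : ℕ} (b : Fin n → ℕ) : U n :=
  ((List.finRange n).map fun i => binom (h i) (b i)).prod

/-- `h̄_D = h_{\bar 1}^{D_1} ⋯ h_{\bar n}^{D_n}`. -/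
def hbarProd {n : ℕ} (D : Fin n → Fin 2) : U n :=
  ((List.finRange n).map fun i => hbar i ^ (D i : ℕ)).prod

/-- The monomial `f_{A^-} binom(h, A_0^0) h̄_{A_1^0} e_{A^+}`. -/
def monomial {n : ℕ} (A : SuperMat n) : U n :=
  fMinus A * hBinom (fun i => A.1 i i) * hbarProd (fun i => A.2 i i) * ePlus A

end

end Queer

namespace Queer

noncomputable section

/-! Let S be the supersymmetric algebra with one variable per unit of 𝔮(n): even t_ij and odd ξ_ij.
A unit X acts on S as multiplication by its own variable plus the superderivation D_X sending the
variable of Y to that of the matrix product XY. The superbracket of two such operators is again of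
this form, because the bracket of 𝔮(n) is the supercommutator of an associative product. So `U` acts
on S (`fockRep`). D_X preserves degree, so in top degree the action is plain multiplication, and u ↦
u·1 sends an ordered monomial to its symbol plus lower terms.

Two facts make this integral. First, every generator of the Kostant form preserves the lattice
spanned over ℤ by the divided power monomials of S (`UZ_le_comap_latticeEnd`). Second, `monomial A`
sends 1 to ± the divided power monomial with exponents A, plus terms of lower degree
(`monomialVec_leading`). By unitriangularity the vectors `monomial A`·1 are independent over ℚ and
span the lattice over ℤ.

Straightening in `U` (`shorter_le_span_monomial`) places `UZ n` in the ℚ-span of the monomials,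
where u ↦ u·1 is injective. As `UZ n`·1 lies in the lattice, `UZ n` lies in their ℤ-span; no
commutation formula between divided powers of e's and f's is needed. Conversely, the monomials
belong to `UZ n` because divided powers of nonsimple root vectors are integral expressions in simple
ones (`divPow_mem_of_commutator`).

Straightening inside a transitive set of positions (below, on or above the diagonal) gives bases of
the three subalgebras in the same way. Each monomial factors through these bases, so multiplication
carries a basis of the tensor product to a basis of `UZ n`. -/

/-- The labels of the basis of the Fock space: a vector of occupation numbers for the bosonic
variables, and the set of occupied fermionic variables. -/
abbrev State (P : Type*) : Type _ := (P → ℕ) × Finset P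

/-- The supersymmetric algebra on even variables `t p` and odd variables `ξ p`, with its basis of
divided power monomials. -/
abbrev Fock (P : Type*) : Type _ := State P →₀ ℚ

/-! ### Creation and annihilation operators on the Fock space -/

section Fock

variable {P : Type*}

/-- The weighted shift operator sending the basis vector `s` to `c s` times the one of `σ s`. -/
def shift (σ : State P → State P) (c : State P → ℚ) : Module.End ℚ (Fock P) :=
  Finsupp.linearCombination ℚ fun s => Finsupp.single (σ s) (c s)

theorem shift_single (σ : State P → State P) (c : State P → ℚ) (s : State P) (r : ℚ) :
    shift σ c (Finsupp.single s r) = Finsupp.single (σ s) (r * c s) := by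
  simp [shift]

theorem end_ext {f g : Module.End ℚ (Fock P)}
    (H : ∀ s, f (Finsupp.single s 1) = g (Finsupp.single s 1)) : f = g :=
  Finsupp.lhom_ext' fun s => LinearMap.ext_ring (H s)

variable [LinearOrder P]

/-- The sign picked up by the odd variable `p` when it moves past the smaller elements of `S`. -/
def sgn (p : P) (S : Finset P) : ℚ := (-1) ^ (S.filter (· < p)).card

theorem sgn_mul_self (p : P) (S : Finset P) : sgn p S * sgn p S = 1 := by
  rw [sgn, ← mul_pow]; norm_num

theorem sgn_insert {p q : P} {S : Finset P} (hq : q ∉ S) :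
    sgn p (insert q S) = if q < p then - sgn p S else sgn p S := by
  unfold sgn
  rw [Finset.filter_insert]
  split_ifs with H
  · rw [Finset.card_insert_of_notMem (by simp [hq]), pow_succ]; ring
  · rfl

theorem sgn_erase {p q : P} {S : Finset P} (hq : q ∈ S) :
    sgn p (S.erase q) = if q < p then - sgn p S else sgn p S := by
  conv_rhs => rw [← Finset.insert_erase hq]
  rw [sgn_insert (Finset.notMem_erase q S)]
  split_ifs <;> simp

/-- Multiplication by the even variable `p`. -/
def up (p : P) : Module.End ℚ (Fock P) :=
  shift (fun s => (Function.update s.1 p (s.1 p + 1), s.2)) fun s => (s.1 p : ℚ) + 1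

/-- The partial derivative in the even variable `p`. -/
def down (p : P) : Module.End ℚ (Fock P) :=
  shift (fun s => (Function.update s.1 p (s.1 p - 1), s.2)) fun s => if s.1 p = 0 then 0 else 1

/-- Left multiplication by the odd variable `p`. -/
def wedge (p : P) : Module.End ℚ (Fock P) :=
  shift (fun s => (s.1, insert p s.2)) fun s => if p ∈ s.2 then 0 else sgn p s.2

/-- The partial derivative in the odd variable `p`. -/
def contr (p : P) : Module.End ℚ (Fock P) :=
  shift (fun s => (s.1, s.2.erase p)) fun s => if p ∈ s.2 then sgn p s.2 else 0

theorem up_up (p q : P) : up p * up q = up q * up p := by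
  refine end_ext fun s => ?_
  rcases eq_or_ne p q with rfl | h
  · rfl
  simp only [up, Module.End.mul_apply, shift_single, ne_eq, h, h.symm, not_false_eq_true,
    Function.update_of_ne, Function.update_comm h]
  congr 1
  ring

theorem down_down (p q : P) : down p * down q = down q * down p := by
  refine end_ext fun s => ?_
  rcases eq_or_ne p q with rfl | h
  · rfl
  simp only [down, Module.End.mul_apply, shift_single, ne_eq, h, h.symm, not_false_eq_true,
    Function.update_of_ne, Function.update_comm h]
  congr 1
  ring

theorem down_up (p q : P) : down p * up q = up q * down p + if p = q then 1 else 0 := by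
  refine end_ext fun s => ?_
  rcases eq_or_ne p q with rfl | h
  -- Truncated subtraction fixes occupation number 0, but the coefficient of `down` vanishes there,
  -- so that case is separate.
  · rcases Nat.eq_zero_or_pos (s.1 p) with h0 | h0
    · have e : Function.update s.1 p 0 = s.1 := by rw [← h0, Function.update_eq_self]
      simp [up, down, shift_single, h0, e]
    · have e : s.1 p - 1 + 1 = s.1 p := by omega
      have e' : ((s.1 p - 1 : ℕ) : ℚ) + 1 = s.1 p := by exact_mod_cast e
      simp [up, down, shift_single, e, e', h0.ne', Finsupp.single_add]
  · simp only [up, down, Module.End.mul_apply, shift_single, ne_eq, h, h.symm, not_false_eq_true,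
      Function.update_of_ne, Function.update_comm h, if_false, add_zero]
    congr 1
    ring

/-- Inserting the smaller of the two variables flips the sign picked up by the larger one and not
conversely, so the two orders differ by exactly one sign. The same count governs `contr_contr` and
`contr_wedge`. -/
theorem wedge_wedge (p q : P) : wedge p * wedge q = - (wedge q * wedge p) := by
  refine end_ext fun s => ?_
  rcases lt_trichotomy p q with h | rfl | h
  all_goals
    simp only [wedge, Module.End.mul_apply, LinearMap.neg_apply, shift_single, Finset.mem_insert]
  · by_cases hp : p ∈ s.2 <;> by_cases hq : q ∈ s.2 <;>
      simp [hp, hq, sgn_insert, h, h.not_gt, h.ne, h.ne', Finset.insert_comm p q, mul_comm,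
        Finsupp.single_neg]
  · simp
  · by_cases hp : p ∈ s.2 <;> by_cases hq : q ∈ s.2 <;>
      simp [hp, hq, sgn_insert, h, h.not_gt, h.ne, h.ne', Finset.insert_comm p q, mul_comm,
        Finsupp.single_neg]

theorem contr_contr (p q : P) : contr p * contr q = - (contr q * contr p) := by
  refine end_ext fun s => ?_
  rcases lt_trichotomy p q with h | rfl | h
  all_goals
    simp only [contr, Module.End.mul_apply, LinearMap.neg_apply, shift_single, Finset.mem_erase]
  · by_cases hp : p ∈ s.2 <;> by_cases hq : q ∈ s.2 <;>
      simp [hp, hq, sgn_erase, h, h.not_gt, h.ne, h.ne', Finset.erase_right_comm (a := p) (b := q),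
        mul_comm, Finsupp.single_neg]
  · simp
  · by_cases hp : p ∈ s.2 <;> by_cases hq : q ∈ s.2 <;>
      simp [hp, hq, sgn_erase, h, h.not_gt, h.ne, h.ne', Finset.erase_right_comm (a := p) (b := q),
        mul_comm, Finsupp.single_neg]

theorem contr_wedge (p q : P) :
    contr p * wedge q = - (wedge q * contr p) + if p = q then 1 else 0 := by
  refine end_ext fun s => ?_
  rcases lt_trichotomy p q with h | rfl | h
  · by_cases hp : p ∈ s.2 <;> by_cases hq : q ∈ s.2 <;>
      simp [contr, wedge, shift_single, hp, hq, sgn_erase, sgn_insert, h, h.not_gt, h.ne, h.ne',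
        Finset.erase_insert_of_ne h.ne', mul_comm, Finsupp.single_neg]
  · by_cases hp : p ∈ s.2 <;>
      simp [contr, wedge, shift_single, hp, sgn_erase, sgn_insert, sgn_mul_self]
  · by_cases hp : p ∈ s.2 <;> by_cases hq : q ∈ s.2 <;>
      simp [contr, wedge, shift_single, hp, hq, sgn_erase, sgn_insert, h, h.not_gt, h.ne, h.ne',
        Finset.erase_insert_of_ne h.ne, mul_comm, Finsupp.single_neg]

theorem wedge_up (p q : P) : wedge p * up q = up q * wedge p :=
  end_ext fun s => by
    simp only [wedge, up, Module.End.mul_apply, shift_single, one_mul]; rw [mul_comm]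

theorem wedge_down (p q : P) : wedge p * down q = down q * wedge p :=
  end_ext fun s => by
    simp only [wedge, down, Module.End.mul_apply, shift_single, one_mul]; rw [mul_comm]

theorem contr_up (p q : P) : contr p * up q = up q * contr p :=
  end_ext fun s => by
    simp only [contr, up, Module.End.mul_apply, shift_single, one_mul]; rw [mul_comm]

theorem contr_down (p q : P) : contr p * down q = down q * contr p :=
  end_ext fun s => by
    simp only [contr, down, Module.End.mul_apply, shift_single, one_mul]; rw [mul_comm]

end Fock

/-! ### Weyl–Clifford relations and the operators representing the units -/

/-- The relations of the Weyl–Clifford superalgebra on even variables `t` and odd variables `ξ`,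
with partial derivatives `d` and `δ`. -/
structure IsWeylClifford {R I : Type*} [Ring R] [DecidableEq I] (t d ξ δ : I → I → R) : Prop where
  tt : ∀ i j k l, t i j * t k l = t k l * t i j
  dd : ∀ i j k l, d i j * d k l = d k l * d i j
  dt : ∀ i j k l, d i j * t k l = t k l * d i j + if i = k ∧ j = l then 1 else 0
  ξξ : ∀ i j k l, ξ i j * ξ k l = - (ξ k l * ξ i j)
  δδ : ∀ i j k l, δ i j * δ k l = - (δ k l * δ i j)
  δξ : ∀ i j k l, δ i j * ξ k l = - (ξ k l * δ i j) + if i = k ∧ j = l then 1 else 0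
  ξt : ∀ i j k l, ξ i j * t k l = t k l * ξ i j
  ξd : ∀ i j k l, ξ i j * d k l = d k l * ξ i j
  δt : ∀ i j k l, δ i j * t k l = t k l * δ i j
  δd : ∀ i j k l, δ i j * d k l = d k l * δ i j

theorem isWeylClifford_fock (n : ℕ) : IsWeylClifford
    (fun i j : Fin n => up (toLex (i, j))) (fun i j => down (toLex (i, j)))
    (fun i j => wedge (toLex (i, j))) (fun i j => contr (toLex (i, j))) where
  tt _ _ _ _ := up_up _ _
  dd _ _ _ _ := down_down _ _
  dt _ _ _ _ := by simp [down_up]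
  ξξ _ _ _ _ := wedge_wedge _ _
  δδ _ _ _ _ := contr_contr _ _
  δξ _ _ _ _ := by simp [contr_wedge]
  ξt _ _ _ _ := wedge_up _ _
  ξd _ _ _ _ := wedge_down _ _
  δt _ _ _ _ := contr_up _ _
  δd _ _ _ _ := contr_down _ _

section

namespace IsWeylClifford

variable {R : Type*} [Ring R] {n : ℕ} {t d ξ δ : Fin n → Fin n → R}

/-- The superderivation of the Weyl–Clifford algebra given by left multiplication by the even
unit `(i, j)`. -/
def evenDer (t d ξ δ : Fin n → Fin n → R) (i j : Fin n) : R :=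
  ∑ l, (t i l * d j l + ξ i l * δ j l)

/-- The superderivation of the Weyl–Clifford algebra given by left multiplication by the odd
unit `(i, j)`. -/
def oddDer (t d ξ δ : Fin n → Fin n → R) (i j : Fin n) : R :=
  ∑ l, (ξ i l * d j l + t i l * δ j l)

theorem td (H : IsWeylClifford t d ξ δ) (i j k l : Fin n) :
    t i j * d k l = d k l * t i j - if k = i ∧ l = j then 1 else 0 := by
  rw [H.dt, add_sub_cancel_right]

theorem ξδ (H : IsWeylClifford t d ξ δ) (i j k l : Fin n) :
    ξ i j * δ k l = - (δ k l * ξ i j) + if k = i ∧ l = j then 1 else 0 := by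
  rw [H.δξ]; abel

/-- The summand with column m commutes with the variable unless m = l and j = k, so only one
correction survives the sum: the variable of the product of units. The seven companions use the same
termwise count, with a supercommutator in the odd-odd cases; on derivatives the action is dual, so
the row test is i = k. -/
theorem evenDer_t (H : IsWeylClifford t d ξ δ) (i j k l : Fin n) :
    evenDer t d ξ δ i j * t k l = t k l * evenDer t d ξ δ i j + if j = k then t i l else 0 := by
  have e : ∀ m, (t i m * d j m + ξ i m * δ j m) * t k l
      = t k l * (t i m * d j m + ξ i m * δ j m)
        + if m = l then (if j = k then t i l else 0) else 0 := by
    intro m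
    rw [add_mul, mul_assoc, mul_assoc, H.dt, H.δt, mul_add (t k l), ← mul_assoc (t k l), H.tt k l,
      ← mul_assoc (ξ i m), H.ξt]
    by_cases h1 : j = k <;> by_cases h2 : m = l <;> simp [h1, h2, mul_add, mul_assoc]
    abel
  rw [evenDer, Finset.sum_mul, Finset.sum_congr rfl fun m _ => e m, Finset.sum_add_distrib,
    Finset.mul_sum]
  simp

theorem evenDer_ξ (H : IsWeylClifford t d ξ δ) (i j k l : Fin n) :
    evenDer t d ξ δ i j * ξ k l = ξ k l * evenDer t d ξ δ i j + if j = k then ξ i l else 0 := by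
  have e : ∀ m, (t i m * d j m + ξ i m * δ j m) * ξ k l
      = ξ k l * (t i m * d j m + ξ i m * δ j m)
        + if m = l then (if j = k then ξ i l else 0) else 0 := by
    intro m
    rw [add_mul, mul_assoc, mul_assoc, ← H.ξd, H.δξ, mul_add (ξ k l), ← mul_assoc (ξ k l), H.ξt k l,
      ← mul_assoc (ξ k l), H.ξξ k l]
    by_cases h1 : j = k <;> by_cases h2 : m = l <;> simp [h1, h2, mul_add, mul_assoc]
    abel
  rw [evenDer, Finset.sum_mul, Finset.sum_congr rfl fun m _ => e m, Finset.sum_add_distrib,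
    Finset.mul_sum]
  simp

theorem evenDer_d (H : IsWeylClifford t d ξ δ) (i j k l : Fin n) :
    evenDer t d ξ δ i j * d k l = d k l * evenDer t d ξ δ i j - if i = k then d j l else 0 := by
  have e : ∀ m, (t i m * d j m + ξ i m * δ j m) * d k l
      = d k l * (t i m * d j m + ξ i m * δ j m)
        - if m = l then (if i = k then d j l else 0) else 0 := by
    intro m
    rw [add_mul, mul_assoc, mul_assoc, H.dd j m, H.δd, mul_add (d k l), ← mul_assoc (t i m), H.td,
      ← mul_assoc (ξ i m), H.ξd]
    by_cases h1 : i = k <;> by_cases h2 : m = l <;>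
      simp [h1, h2, eq_comm (a := k) (b := i), eq_comm (a := l) (b := m), sub_mul, mul_assoc]
    abel
  rw [evenDer, Finset.sum_mul, Finset.sum_congr rfl fun m _ => e m, Finset.sum_sub_distrib,
    Finset.mul_sum]
  simp

theorem evenDer_δ (H : IsWeylClifford t d ξ δ) (i j k l : Fin n) :
    evenDer t d ξ δ i j * δ k l = δ k l * evenDer t d ξ δ i j - if i = k then δ j l else 0 := by
  have e : ∀ m, (t i m * d j m + ξ i m * δ j m) * δ k l
      = δ k l * (t i m * d j m + ξ i m * δ j m)
        - if m = l then (if i = k then δ j l else 0) else 0 := by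
    intro m
    rw [add_mul, mul_assoc, mul_assoc, ← H.δd, H.δδ j m, mul_add (δ k l), ← mul_assoc (t i m),
      ← H.δt, mul_neg, ← mul_assoc (ξ i m), H.ξδ]
    by_cases h1 : i = k <;> by_cases h2 : m = l <;>
      simp [h1, h2, eq_comm (a := k) (b := i), eq_comm (a := l) (b := m), add_mul, mul_assoc]
    abel
  rw [evenDer, Finset.sum_mul, Finset.sum_congr rfl fun m _ => e m, Finset.sum_sub_distrib,
    Finset.mul_sum]
  simp

theorem oddDer_t (H : IsWeylClifford t d ξ δ) (i j k l : Fin n) :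
    oddDer t d ξ δ i j * t k l = t k l * oddDer t d ξ δ i j + if j = k then ξ i l else 0 := by
  have e : ∀ m, (ξ i m * d j m + t i m * δ j m) * t k l
      = t k l * (ξ i m * d j m + t i m * δ j m)
        + if m = l then (if j = k then ξ i l else 0) else 0 := by
    intro m
    rw [add_mul, mul_assoc, mul_assoc, H.dt, H.δt, mul_add (t k l), ← mul_assoc (t k l), ← H.ξt,
      ← mul_assoc (t k l), H.tt k l]
    by_cases h1 : j = k <;> by_cases h2 : m = l <;> simp [h1, h2, mul_add, mul_assoc]
    abel
  rw [oddDer, Finset.sum_mul, Finset.sum_congr rfl fun m _ => e m, Finset.sum_add_distrib,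
    Finset.mul_sum]
  simp

theorem oddDer_ξ (H : IsWeylClifford t d ξ δ) (i j k l : Fin n) :
    oddDer t d ξ δ i j * ξ k l
      = - (ξ k l * oddDer t d ξ δ i j) + if j = k then t i l else 0 := by
  have e : ∀ m, (ξ i m * d j m + t i m * δ j m) * ξ k l
      = - (ξ k l * (ξ i m * d j m + t i m * δ j m))
        + if m = l then (if j = k then t i l else 0) else 0 := by
    intro m
    rw [add_mul, mul_assoc, mul_assoc, ← H.ξd, H.δξ, mul_add (ξ k l), ← mul_assoc (ξ k l), H.ξξ k l,
      ← mul_assoc (ξ k l), H.ξt k l]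
    by_cases h1 : j = k <;> by_cases h2 : m = l <;> simp [h1, h2, mul_add, mul_assoc] <;>
      abel
  rw [oddDer, Finset.sum_mul, Finset.sum_congr rfl fun m _ => e m, Finset.sum_add_distrib,
    Finset.mul_sum, Finset.sum_neg_distrib]
  simp

theorem oddDer_d (H : IsWeylClifford t d ξ δ) (i j k l : Fin n) :
    oddDer t d ξ δ i j * d k l = d k l * oddDer t d ξ δ i j - if i = k then δ j l else 0 := by
  have e : ∀ m, (ξ i m * d j m + t i m * δ j m) * d k l
      = d k l * (ξ i m * d j m + t i m * δ j m)
        - if m = l then (if i = k then δ j l else 0) else 0 := by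
    intro m
    rw [add_mul, mul_assoc, mul_assoc, H.dd j m, H.δd, mul_add (d k l), ← mul_assoc (t i m), H.td,
      ← mul_assoc (ξ i m), H.ξd]
    by_cases h1 : i = k <;> by_cases h2 : m = l <;>
      simp [h1, h2, eq_comm (a := k) (b := i), eq_comm (a := l) (b := m), sub_mul, mul_assoc]
    abel
  rw [oddDer, Finset.sum_mul, Finset.sum_congr rfl fun m _ => e m, Finset.sum_sub_distrib,
    Finset.mul_sum]
  simp

theorem oddDer_δ (H : IsWeylClifford t d ξ δ) (i j k l : Fin n) :
    oddDer t d ξ δ i j * δ k l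
      = - (δ k l * oddDer t d ξ δ i j) + if i = k then d j l else 0 := by
  have e : ∀ m, (ξ i m * d j m + t i m * δ j m) * δ k l
      = - (δ k l * (ξ i m * d j m + t i m * δ j m))
        + if m = l then (if i = k then d j l else 0) else 0 := by
    intro m
    rw [add_mul, mul_assoc, mul_assoc, ← H.δd, H.δδ j m, mul_add (δ k l), mul_neg,
      ← mul_assoc (t i m), ← H.δt, ← mul_assoc (ξ i m), H.ξδ]
    by_cases h1 : i = k <;> by_cases h2 : m = l <;>
      simp [h1, h2, eq_comm (a := k) (b := i), eq_comm (a := l) (b := m), add_mul, mul_assoc] <;> abel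
  rw [oddDer, Finset.sum_mul, Finset.sum_congr rfl fun m _ => e m, Finset.sum_add_distrib,
    Finset.mul_sum, Finset.sum_neg_distrib]
  simp

/-- Each summand of the second operator is a variable times a derivative. Moving the first operator
past both gives one correction from the variable and one from the derivative: the two terms of the
bracket. -/
theorem evenDer_evenDer (H : IsWeylClifford t d ξ δ) (i j k l : Fin n) :
    evenDer t d ξ δ i j * evenDer t d ξ δ k l
      = evenDer t d ξ δ k l * evenDer t d ξ δ i j + (if j = k then evenDer t d ξ δ i l else 0)
        - if l = i then evenDer t d ξ δ k j else 0 := by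
  have e : ∀ m, evenDer t d ξ δ i j * (t k m * d l m + ξ k m * δ l m)
      = (t k m * d l m + ξ k m * δ l m) * evenDer t d ξ δ i j
        + (if j = k then t i m * d l m + ξ i m * δ l m else 0)
        - if l = i then t k m * d j m + ξ k m * δ j m else 0 := by
    intro m
    rw [mul_add, ← mul_assoc, ← mul_assoc, H.evenDer_t, H.evenDer_ξ, add_mul, add_mul,
      mul_assoc, mul_assoc, H.evenDer_d, H.evenDer_δ]
    by_cases h1 : j = k <;> by_cases h2 : l = i <;>
      simp [h1, h2, eq_comm (a := i) (b := l), mul_sub, add_mul, mul_assoc] <;> abel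
  conv_lhs => rw [evenDer.eq_def t d ξ δ k l]
  rw [Finset.mul_sum, Finset.sum_congr rfl fun m _ => e m, Finset.sum_sub_distrib,
    Finset.sum_add_distrib, ← Finset.sum_mul]
  split_ifs <;> simp [evenDer]

theorem evenDer_oddDer (H : IsWeylClifford t d ξ δ) (i j k l : Fin n) :
    evenDer t d ξ δ i j * oddDer t d ξ δ k l
      = oddDer t d ξ δ k l * evenDer t d ξ δ i j + (if j = k then oddDer t d ξ δ i l else 0)
        - if l = i then oddDer t d ξ δ k j else 0 := by
  have e : ∀ m, evenDer t d ξ δ i j * (ξ k m * d l m + t k m * δ l m)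
      = (ξ k m * d l m + t k m * δ l m) * evenDer t d ξ δ i j
        + (if j = k then ξ i m * d l m + t i m * δ l m else 0)
        - if l = i then ξ k m * d j m + t k m * δ j m else 0 := by
    intro m
    rw [mul_add, ← mul_assoc, ← mul_assoc, H.evenDer_t, H.evenDer_ξ, add_mul, add_mul,
      mul_assoc, mul_assoc, H.evenDer_d, H.evenDer_δ]
    by_cases h1 : j = k <;> by_cases h2 : l = i <;>
      simp [h1, h2, eq_comm (a := i) (b := l), mul_sub, add_mul, mul_assoc] <;> abel
  conv_lhs => rw [oddDer.eq_def t d ξ δ k l]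
  rw [Finset.mul_sum, Finset.sum_congr rfl fun m _ => e m, Finset.sum_sub_distrib,
    Finset.sum_add_distrib, ← Finset.sum_mul]
  split_ifs <;> simp [oddDer]

theorem oddDer_oddDer (H : IsWeylClifford t d ξ δ) (i j k l : Fin n) :
    oddDer t d ξ δ i j * oddDer t d ξ δ k l
      = - (oddDer t d ξ δ k l * oddDer t d ξ δ i j)
        + (if j = k then evenDer t d ξ δ i l else 0)
        + if l = i then evenDer t d ξ δ k j else 0 := by
  have e : ∀ m, oddDer t d ξ δ i j * (ξ k m * d l m + t k m * δ l m)
      = - ((ξ k m * d l m + t k m * δ l m) * oddDer t d ξ δ i j)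
        + (if j = k then t i m * d l m + ξ i m * δ l m else 0)
        + if l = i then t k m * d j m + ξ k m * δ j m else 0 := by
    intro m
    rw [mul_add, ← mul_assoc, ← mul_assoc, H.oddDer_t, H.oddDer_ξ, add_mul, add_mul,
      neg_mul, mul_assoc, mul_assoc, H.oddDer_d, H.oddDer_δ]
    by_cases h1 : j = k <;> by_cases h2 : l = i <;>
      simp [h1, h2, eq_comm (a := i) (b := l), mul_sub, mul_add, add_mul, mul_assoc] <;> abel
  conv_lhs => rw [oddDer.eq_def t d ξ δ k l]
  rw [Finset.mul_sum, Finset.sum_congr rfl fun m _ => e m, Finset.sum_add_distrib,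
    Finset.sum_add_distrib, Finset.sum_neg_distrib, ← Finset.sum_mul]
  split_ifs <;> simp [evenDer, oddDer]

/-- The operator by which `x i j` acts. -/
def evenOp (t d ξ δ : Fin n → Fin n → R) (i j : Fin n) : R := t i j + evenDer t d ξ δ i j

/-- The operator by which `xbar i j` acts. -/
def oddOp (t d ξ δ : Fin n → Fin n → R) (i j : Fin n) : R := ξ i j + oddDer t d ξ δ i j

/-- The variables commute, the derivations close under the bracket, and the two mixed terms produce
the variables of XY and YX. Together they rebuild variable plus derivation for the bracket. -/
theorem evenOp_evenOp (H : IsWeylClifford t d ξ δ) (i j k l : Fin n) :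
    evenOp t d ξ δ i j * evenOp t d ξ δ k l
      = evenOp t d ξ δ k l * evenOp t d ξ δ i j + (if j = k then evenOp t d ξ δ i l else 0)
        - if l = i then evenOp t d ξ δ k j else 0 := by
  simp only [evenOp, add_mul, mul_add, H.evenDer_t, H.evenDer_evenDer i j k l, H.tt i j k l]
  split_ifs <;> abel

theorem evenOp_oddOp (H : IsWeylClifford t d ξ δ) (i j k l : Fin n) :
    evenOp t d ξ δ i j * oddOp t d ξ δ k l
      = oddOp t d ξ δ k l * evenOp t d ξ δ i j + (if j = k then oddOp t d ξ δ i l else 0)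
        - if l = i then oddOp t d ξ δ k j else 0 := by
  simp only [evenOp, oddOp, add_mul, mul_add, H.evenDer_ξ, H.evenDer_oddDer, H.oddDer_t k l, H.ξt k l]
  split_ifs <;> abel

theorem oddOp_oddOp (H : IsWeylClifford t d ξ δ) (i j k l : Fin n) :
    oddOp t d ξ δ i j * oddOp t d ξ δ k l
      = - (oddOp t d ξ δ k l * oddOp t d ξ δ i j) + (if j = k then evenOp t d ξ δ i l else 0)
        + if l = i then evenOp t d ξ δ k j else 0 := by
  simp only [evenOp, oddOp, add_mul, mul_add, H.oddDer_ξ, H.oddDer_oddDer i j k l, H.ξξ i j k l]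
  split_ifs <;> abel

end IsWeylClifford

end

/-! ### Relations between the units in the enveloping superalgebra, and the Fock representation -/

section

variable {n : ℕ}

/-- The even elements of `𝔮(n)`, as the image of the `n × n` matrices. -/
def evenEmb (n : ℕ) : Matrix (Fin n) (Fin n) ℚ →ₗ[ℚ] q n where
  toFun A := ⟨Matrix.fromBlocks A 0 0 A, A, 0, rfl⟩
  map_add' A B := Subtype.ext (by simp [Matrix.fromBlocks_add])
  map_smul' c A := Subtype.ext (by simp [Matrix.fromBlocks_smul])

/-- The odd elements of `𝔮(n)`, as the image of the `n × n` matrices. -/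
def oddEmb (n : ℕ) : Matrix (Fin n) (Fin n) ℚ →ₗ[ℚ] q n where
  toFun B := ⟨Matrix.fromBlocks 0 B B 0, 0, B, rfl⟩
  map_add' A B := Subtype.ext (by simp [Matrix.fromBlocks_add])
  map_smul' c A := Subtype.ext (by simp [Matrix.fromBlocks_smul])

theorem evenEmb_single (i j : Fin n) : evenEmb n (Matrix.single i j 1) = evenUnit i j := by
  ext (a | a) (b | b) <;> simp [evenEmb, evenUnit, Matrix.single_apply]

theorem oddEmb_single (i j : Fin n) : oddEmb n (Matrix.single i j 1) = oddUnit i j := by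
  ext (a | a) (b | b) <;> simp [oddEmb, oddUnit, Matrix.single_apply]

theorem isHomogeneous_evenEmb (A : Matrix (Fin n) (Fin n) ℚ) : IsHomogeneous 0 (evenEmb n A) :=
  component_fromBlocks_zero A 0 0 A

theorem isHomogeneous_oddEmb (A : Matrix (Fin n) (Fin n) ℚ) : IsHomogeneous 1 (oddEmb n A) :=
  component_fromBlocks_one 0 A A 0

theorem IsHomogeneous.exists_eq_evenEmb {u : q n} (hu : IsHomogeneous 0 u) :
    ∃ A, u = evenEmb n A := by
  obtain ⟨_, A, B, rfl⟩ := u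
  refine ⟨A, Subtype.ext ?_⟩
  rw [IsHomogeneous, component_fromBlocks_zero] at hu
  exact hu.symm

theorem IsHomogeneous.exists_eq_oddEmb {u : q n} (hu : IsHomogeneous 1 u) :
    ∃ A, u = oddEmb n A := by
  obtain ⟨_, A, B, rfl⟩ := u
  refine ⟨B, Subtype.ext ?_⟩
  rw [IsHomogeneous, component_fromBlocks_one] at hu
  exact hu.symm

theorem qBracket_even_even (A B : Matrix (Fin n) (Fin n) ℚ) :
    qBracket (evenEmb n A) (evenEmb n B) = evenEmb n (A * B - B * A) := by
  refine Subtype.ext ?_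
  simp [qBracket, evenEmb, bracket_eq, component_fromBlocks_zero, component_fromBlocks_one,
    Matrix.fromBlocks_multiply, sub_eq_add_neg, Matrix.fromBlocks_neg, Matrix.fromBlocks_add]

theorem qBracket_even_odd (A B : Matrix (Fin n) (Fin n) ℚ) :
    qBracket (evenEmb n A) (oddEmb n B) = oddEmb n (A * B - B * A) := by
  refine Subtype.ext ?_
  simp [qBracket, evenEmb, oddEmb, bracket_eq, component_fromBlocks_zero, component_fromBlocks_one,
    Matrix.fromBlocks_multiply, sub_eq_add_neg, Matrix.fromBlocks_neg, Matrix.fromBlocks_add]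

theorem qBracket_odd_even (A B : Matrix (Fin n) (Fin n) ℚ) :
    qBracket (oddEmb n A) (evenEmb n B) = oddEmb n (A * B - B * A) := by
  refine Subtype.ext ?_
  simp [qBracket, evenEmb, oddEmb, bracket_eq, component_fromBlocks_zero, component_fromBlocks_one,
    Matrix.fromBlocks_multiply, sub_eq_add_neg, Matrix.fromBlocks_neg, Matrix.fromBlocks_add]

theorem qBracket_odd_odd (A B : Matrix (Fin n) (Fin n) ℚ) :
    qBracket (oddEmb n A) (oddEmb n B) = evenEmb n (A * B + B * A) := by
  refine Subtype.ext ?_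
  simp [qBracket, evenEmb, oddEmb, bracket_eq, component_fromBlocks_zero, component_fromBlocks_one,
    Matrix.fromBlocks_multiply, Matrix.fromBlocks_add]

theorem toU_mul_toU (p p' : ZMod 2) (u v : q n) (hu : IsHomogeneous p u) (hv : IsHomogeneous p' v) :
    toU n u * toU n v = toU n (qBracket u v)
      + (-1 : ℚ) ^ (p.val * p'.val) • (toU n v * toU n u) := by
  have h := RingQuot.mkAlgHom_rel ℚ (Rel.comm p p' u v hu hv)
  rw [map_mul, map_add, map_smul, map_mul] at h
  exact h

theorem single_mul_single_eq (i j k l : Fin n) :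
    (Matrix.single i j 1 * Matrix.single k l 1 : Matrix (Fin n) (Fin n) ℚ)
      = if j = k then Matrix.single i l 1 else 0 := by
  split_ifs with h
  · subst h; simp
  · simp [h]

theorem x_mul_x (i j k l : Fin n) :
    (x i j * x k l : U n)
      = x k l * x i j + (if j = k then x i l else 0) - if l = i then x k j else 0 := by
  have h := toU_mul_toU 0 0 _ _ (isHomogeneous_evenEmb (Matrix.single i j 1))
    (isHomogeneous_evenEmb (n := n) (Matrix.single k l 1))
  rw [qBracket_even_even, single_mul_single_eq, single_mul_single_eq, evenEmb_single,
    evenEmb_single] at h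
  refine h.trans ?_
  split_ifs <;> simp [x, evenEmb_single] <;> abel

theorem x_mul_xbar (i j k l : Fin n) :
    (x i j * xbar k l : U n)
      = xbar k l * x i j + (if j = k then xbar i l else 0) - if l = i then xbar k j else 0 := by
  have h := toU_mul_toU 0 1 _ _ (isHomogeneous_evenEmb (Matrix.single i j 1))
    (isHomogeneous_oddEmb (n := n) (Matrix.single k l 1))
  rw [qBracket_even_odd, single_mul_single_eq, single_mul_single_eq, evenEmb_single,
    oddEmb_single] at h
  refine h.trans ?_
  split_ifs <;> simp [x, xbar, oddEmb_single] <;> abel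

theorem xbar_mul_xbar (i j k l : Fin n) :
    (xbar i j * xbar k l : U n)
      = - (xbar k l * xbar i j) + (if j = k then x i l else 0) + if l = i then x k j else 0 := by
  have h := toU_mul_toU 1 1 _ _ (isHomogeneous_oddEmb (Matrix.single i j 1))
    (isHomogeneous_oddEmb (n := n) (Matrix.single k l 1))
  rw [qBracket_odd_odd, single_mul_single_eq, single_mul_single_eq, oddEmb_single,
    oddEmb_single] at h
  refine h.trans ?_
  split_ifs <;> simp [x, xbar, evenEmb_single, ZMod.val_one] <;> abel

section Lift

variable {R : Type*} [Ring R] [Algebra ℚ R]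

/-- Both sides are bilinear, so matrix units suffice. The parameter s is the sign in the
superbracket, which lets one statement serve every parity. -/
theorem superbracket_of_single (F G K : Matrix (Fin n) (Fin n) ℚ →ₗ[ℚ] R) (s : ℚ)
    (H : ∀ i j k l, F (Matrix.single i j 1) * G (Matrix.single k l 1)
      = K (Matrix.single i j 1 * Matrix.single k l 1
        - s • (Matrix.single k l 1 * Matrix.single i j 1))
        + s • (G (Matrix.single k l 1) * F (Matrix.single i j 1)))
    (A B : Matrix (Fin n) (Fin n) ℚ) :
    F A * G B = K (A * B - s • (B * A)) + s • (G B * F A) := by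
  induction A using Matrix.induction_on' with
  | h_zero => simp
  | h_add A A' hA hA' =>
    simp only [map_add, add_mul, mul_add, smul_add, map_sub, map_smul] at hA hA' ⊢
    rw [hA, hA']; abel
  | h_std_basis i j r =>
    induction B using Matrix.induction_on' with
    | h_zero => simp
    | h_add A A' hA hA' =>
      simp only [map_add, add_mul, mul_add, smul_add, map_sub, map_smul] at hA hA' ⊢
      rw [hA, hA']; abel
    | h_std_basis k l r' =>
      have e : ∀ (i j : Fin n) (r : ℚ), Matrix.single i j r = r • Matrix.single i j (1 : ℚ) :=
        fun i j r => by rw [Matrix.smul_single]; simp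
      rw [e i j r, e k l r']
      simp only [map_smul, smul_mul_assoc, mul_smul_comm, H i j k l, map_sub, smul_add, smul_sub,
        smul_comm r' r, smul_comm s r', smul_comm s r]

/-- The linear map on matrices with prescribed values on the matrix units. -/
def matrixLift (f : Fin n → Fin n → R) : Matrix (Fin n) (Fin n) ℚ →ₗ[ℚ] R :=
  ∑ i, ∑ j, (LinearMap.toSpanSingleton ℚ R (f i j)) ∘ₗ Matrix.entryLinearMap ℚ ℚ i j

theorem matrixLift_apply (f : Fin n → Fin n → R) (A : Matrix (Fin n) (Fin n) ℚ) :
    matrixLift f A = ∑ i, ∑ j, A i j • f i j := by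
  simp [matrixLift]

theorem matrixLift_single (f : Fin n → Fin n → R) (i j : Fin n) :
    matrixLift f (Matrix.single i j 1) = f i j := by
  simp [matrixLift_apply, Matrix.single_apply, ite_and]

/-- The linear map on `𝔮(n)` with prescribed values on the even and the odd units. -/
def qLift (e o : Fin n → Fin n → R) : q n →ₗ[ℚ] R where
  toFun u := matrixLift e u.1.toBlocks₁₁ + matrixLift o u.1.toBlocks₁₂
  map_add' u v := by
    simp only [matrixLift_apply, Submodule.coe_add, Matrix.toBlocks₁₁, Matrix.toBlocks₁₂,
      Matrix.of_apply, Matrix.add_apply, add_smul, Finset.sum_add_distrib]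
    abel
  map_smul' c u := by
    simp only [matrixLift_apply, Submodule.coe_smul, Matrix.toBlocks₁₁, Matrix.toBlocks₁₂,
      Matrix.of_apply, Matrix.smul_apply, smul_assoc, Finset.smul_sum, smul_add, RingHom.id_apply]

theorem qLift_evenEmb (e o : Fin n → Fin n → R) (A : Matrix (Fin n) (Fin n) ℚ) :
    qLift e o (evenEmb n A) = matrixLift e A := by
  simp [qLift, evenEmb]

theorem qLift_oddEmb (e o : Fin n → Fin n → R) (A : Matrix (Fin n) (Fin n) ℚ) :
    qLift e o (oddEmb n A) = matrixLift o A := by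
  simp [qLift, oddEmb]

/-- A family of elements satisfying the relations of the units of `𝔮(n)`. -/
structure IsQueerFamily (e o : Fin n → Fin n → R) : Prop where
  ee : ∀ i j k l, e i j * e k l
    = e k l * e i j + (if j = k then e i l else 0) - if l = i then e k j else 0
  eo : ∀ i j k l, e i j * o k l
    = o k l * e i j + (if j = k then o i l else 0) - if l = i then o k j else 0
  oo : ∀ i j k l, o i j * o k l
    = - (o k l * o i j) + (if j = k then e i l else 0) + if l = i then e k j else 0

theorem IsQueerFamily.qLift_rel {e o : Fin n → Fin n → R} (H : IsQueerFamily e o) (p p' : ZMod 2)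
    (u v : q n) (hu : IsHomogeneous p u) (hv : IsHomogeneous p' v) :
    qLift e o u * qLift e o v = qLift e o (qBracket u v)
      + (-1 : ℚ) ^ (p.val * p'.val) • (qLift e o v * qLift e o u) := by
  have h2 : ∀ p : ZMod 2, p = 0 ∨ p = 1 := by decide
  rcases h2 p with rfl | rfl <;> rcases h2 p' with rfl | rfl
  · obtain ⟨A, rfl⟩ := hu.exists_eq_evenEmb
    obtain ⟨B, rfl⟩ := hv.exists_eq_evenEmb
    simp only [qBracket_even_even, qLift_evenEmb]
    rw [superbracket_of_single (matrixLift e) (matrixLift e) (matrixLift e) 1]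
    · simp
    · intro i j k l
      rw [single_mul_single_eq, single_mul_single_eq]
      simp only [matrixLift_single, H.ee i j k l]
      split_ifs <;> simp [matrixLift_single] <;> abel
  · obtain ⟨A, rfl⟩ := hu.exists_eq_evenEmb
    obtain ⟨B, rfl⟩ := hv.exists_eq_oddEmb
    simp only [qBracket_even_odd, qLift_evenEmb, qLift_oddEmb]
    rw [superbracket_of_single (matrixLift e) (matrixLift o) (matrixLift o) 1]
    · simp
    · intro i j k l
      rw [single_mul_single_eq, single_mul_single_eq]
      simp only [matrixLift_single, H.eo i j k l]
      split_ifs <;> simp [matrixLift_single] <;> abel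
  · obtain ⟨A, rfl⟩ := hu.exists_eq_oddEmb
    obtain ⟨B, rfl⟩ := hv.exists_eq_evenEmb
    simp only [qBracket_odd_even, qLift_evenEmb, qLift_oddEmb]
    rw [superbracket_of_single (matrixLift o) (matrixLift e) (matrixLift o) 1]
    · simp
    · intro i j k l
      rw [single_mul_single_eq, single_mul_single_eq]
      -- The odd-even relation is the even-odd one with the factors interchanged, solved for the
      -- other product.
      simp only [matrixLift_single, H.eo k l i j]
      split_ifs <;> simp [matrixLift_single]
  · obtain ⟨A, rfl⟩ := hu.exists_eq_oddEmb
    obtain ⟨B, rfl⟩ := hv.exists_eq_oddEmb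
    simp only [qBracket_odd_odd, qLift_evenEmb, qLift_oddEmb]
    rw [superbracket_of_single (matrixLift o) (matrixLift o) (matrixLift e) (-1)]
    · simp [ZMod.val_one]
    · intro i j k l
      rw [single_mul_single_eq, single_mul_single_eq]
      simp only [matrixLift_single, H.oo i j k l]
      split_ifs <;> simp [matrixLift_single] <;> abel

/-- The algebra homomorphism from `U(𝔮(n))` with prescribed values on the units. -/
def IsQueerFamily.lift {e o : Fin n → Fin n → R} (H : IsQueerFamily e o) : U n →ₐ[ℚ] R :=
  RingQuot.liftAlgHom ℚ ⟨TensorAlgebra.lift ℚ (qLift e o), by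
    rintro _ _ ⟨p, p', u, v, hu, hv⟩
    simpa using H.qLift_rel p p' u v hu hv⟩

theorem IsQueerFamily.lift_toU {e o : Fin n → Fin n → R} (H : IsQueerFamily e o) (u : q n) :
    H.lift (toU n u) = qLift e o u := by
  have h : H.lift (toU n u) = TensorAlgebra.lift ℚ (qLift e o) (TensorAlgebra.ι ℚ u) :=
    RingQuot.liftAlgHom_mkAlgHom_apply ..
  rw [h, TensorAlgebra.lift_ι_apply]

theorem IsQueerFamily.lift_x {e o : Fin n → Fin n → R} (H : IsQueerFamily e o) (i j : Fin n) :
    H.lift (x i j) = e i j := by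
  rw [x, H.lift_toU, ← evenEmb_single, qLift_evenEmb, matrixLift_single]

theorem IsQueerFamily.lift_xbar {e o : Fin n → Fin n → R} (H : IsQueerFamily e o) (i j : Fin n) :
    H.lift (xbar i j) = o i j := by
  rw [xbar, H.lift_toU, ← oddEmb_single, qLift_oddEmb, matrixLift_single]

end Lift

/-- The operator of `x i j` on the Fock space. -/
def fockE (i j : Fin n) : Module.End ℚ (Fock (Fin n ×ₗ Fin n)) :=
  IsWeylClifford.evenOp (fun i j => up (toLex (i, j))) (fun i j => down (toLex (i, j)))
    (fun i j => wedge (toLex (i, j))) (fun i j => contr (toLex (i, j))) i j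

/-- The operator of `xbar i j` on the Fock space. -/
def fockO (i j : Fin n) : Module.End ℚ (Fock (Fin n ×ₗ Fin n)) :=
  IsWeylClifford.oddOp (fun i j => up (toLex (i, j))) (fun i j => down (toLex (i, j)))
    (fun i j => wedge (toLex (i, j))) (fun i j => contr (toLex (i, j))) i j

theorem isQueerFamily_fock (n : ℕ) : IsQueerFamily (fockE (n := n)) fockO where
  ee := (isWeylClifford_fock n).evenOp_evenOp
  eo := (isWeylClifford_fock n).evenOp_oddOp
  oo := (isWeylClifford_fock n).oddOp_oddOp

/-- The action of `U(𝔮(n))` on the Fock space. -/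
def fockRep (n : ℕ) : U n →ₐ[ℚ] Module.End ℚ (Fock (Fin n ×ₗ Fin n)) :=
  (isQueerFamily_fock n).lift

theorem fockRep_x (i j : Fin n) : fockRep n (x i j) = fockE i j := IsQueerFamily.lift_x _ i j

theorem fockRep_xbar (i j : Fin n) : fockRep n (xbar i j) = fockO i j :=
  IsQueerFamily.lift_xbar _ i j

end

/-! ### The integral lattice, divided powers and falling factorials -/

section

theorem mul_mul_self_eq_zero_of_anticommute {R : Type*} [Ring R] {a b : R} (ha : a * a = 0)
    (h : b * a = -(a * b)) : a * b * (a * b) = 0 := by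
  rw [mul_assoc, ← mul_assoc b, h, neg_mul, mul_neg, mul_assoc, ← mul_assoc, ha]
  simp

theorem commute_mul_mul_of_anticommute {R : Type*} [Ring R] {a b c d : R} (hac : a * c = -(c * a))
    (had : a * d = -(d * a)) (hbc : b * c = -(c * b)) (hbd : b * d = -(d * b)) :
    Commute (a * b) (c * d) := by
  have h1 : Commute (a * b) c := by
    rw [Commute, SemiconjBy, mul_assoc, hbc, mul_neg, ← mul_assoc, hac, neg_mul, neg_neg, mul_assoc]
  have h2 : Commute (a * b) d := by
    rw [Commute, SemiconjBy, mul_assoc, hbd, mul_neg, ← mul_assoc, had, neg_mul, neg_neg, mul_assoc]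
  exact h1.mul_right h2

/-- Since C(i+j, i)/(i+j)! = 1/(i! j!), this turns a term of a binomial expansion into a product of
divided powers. -/
theorem inv_factorial_smul_choose_smul {A : Type*} [Ring A] [Algebra ℚ A] (i j : ℕ) (X Y : A) :
    (((i + j).factorial : ℚ)⁻¹) • ((i + j).choose i • (X * Y))
      = ((i.factorial : ℚ)⁻¹ • X) * ((j.factorial : ℚ)⁻¹ • Y) := by
  rw [smul_mul_smul_comm, ← Nat.cast_smul_eq_nsmul ℚ, smul_smul, Nat.cast_add_choose]
  congr 1
  field_simp

section Lattice

variable {P : Type*}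

/-- The lattice spanned by the divided power monomials. -/
def lattice (P : Type*) : Submodule ℤ (Fock P) :=
  Submodule.span ℤ (Set.range fun s : State P => Finsupp.single s (1 : ℚ))

/-- The ring of operators preserving the lattice. -/
def latticeEnd (P : Type*) : Subalgebra ℤ (Module.End ℚ (Fock P)) where
  carrier := {T | ∀ v ∈ lattice P, T v ∈ lattice P}
  mul_mem' hS hT v hv := hS _ (hT v hv)
  add_mem' hS hT v hv := add_mem (hS v hv) (hT v hv)
  algebraMap_mem' r v hv := by
    have e : (algebraMap ℤ (Module.End ℚ (Fock P)) r) v = r • v := by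
      rw [algebraMap_int_eq, eq_intCast]
      exact Module.End.intCast_apply r v
    rw [e]
    exact Submodule.smul_mem _ _ hv

theorem mem_latticeEnd_of_single {T : Module.End ℚ (Fock P)}
    (H : ∀ s, T (Finsupp.single s 1) ∈ lattice P) : T ∈ latticeEnd P := by
  intro v hv
  induction hv using Submodule.span_induction with
  | mem _ h => obtain ⟨s, rfl⟩ := h; exact H s
  | zero => simp
  | add v w _ _ hv hw => rw [map_add]; exact add_mem hv hw
  | smul r v _ hv => rw [map_zsmul]; exact Submodule.smul_mem _ _ hv

theorem single_intCast_mem_lattice (s : State P) (r : ℤ) :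
    Finsupp.single s (r : ℚ) ∈ lattice P := by
  have e : Finsupp.single s (r : ℚ) = r • Finsupp.single s (1 : ℚ) := by simp
  rw [e]
  exact Submodule.smul_mem _ _ (Submodule.subset_span ⟨s, rfl⟩)

/-- All divided powers of the operator preserve the lattice. -/
def HasDividedPowers (T : Module.End ℚ (Fock P)) : Prop :=
  ∀ k : ℕ, ((k.factorial : ℚ)⁻¹) • T ^ k ∈ latticeEnd P

theorem HasDividedPowers.zero : HasDividedPowers (0 : Module.End ℚ (Fock P)) := by
  rintro (_ | k)
  · simp
  · simp

/-- For commuting operators (S + T)^(k) is the sum of the S^(i) T^(j) with i + j = k, with no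
denominators left. -/
theorem HasDividedPowers.add {S T : Module.End ℚ (Fock P)} (hS : HasDividedPowers S)
    (hT : HasDividedPowers T) (h : Commute S T) : HasDividedPowers (S + T) := by
  intro k
  rw [h.add_pow', Finset.smul_sum]
  refine sum_mem fun m hm => ?_
  obtain rfl := Finset.HasAntidiagonal.mem_antidiagonal.1 hm
  rw [inv_factorial_smul_choose_smul]
  exact mul_mem (hS _) (hT _)

theorem HasDividedPowers.sum {ι : Type*} (s : Finset ι) (T : ι → Module.End ℚ (Fock P))
    (hT : ∀ i ∈ s, HasDividedPowers (T i)) (h : ∀ i ∈ s, ∀ j ∈ s, Commute (T i) (T j)) :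
    HasDividedPowers (∑ i ∈ s, T i) := by
  classical
  induction s using Finset.induction_on with
  | empty => simpa using HasDividedPowers.zero
  | insert a s ha ih =>
    rw [Finset.sum_insert ha]
    refine HasDividedPowers.add (hT _ (by simp))
      (ih (fun i hi => hT i (by simp [hi])) fun i hi j hj => h i (by simp [hi]) j (by simp [hj])) ?_
    exact Commute.sum_right _ _ _ fun i hi => h a (by simp) i (by simp [hi])

theorem HasDividedPowers.of_mul_self {T : Module.End ℚ (Fock P)} (hT : T ∈ latticeEnd P)
    (h : T * T = 0) : HasDividedPowers T := by
  rintro (_ | _ | k)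
  · simp
  · simpa using hT
  · rw [pow_succ, pow_succ, mul_assoc, h]; simp

variable [LinearOrder P]

theorem up_mem_latticeEnd (p : P) : up p ∈ latticeEnd P :=
  mem_latticeEnd_of_single fun s => by
    rw [up, shift_single, one_mul]
    exact_mod_cast single_intCast_mem_lattice _ (s.1 p + 1 : ℤ)

theorem down_mem_latticeEnd (p : P) : down p ∈ latticeEnd P :=
  mem_latticeEnd_of_single fun s => by
    rw [down, shift_single, one_mul]
    exact_mod_cast single_intCast_mem_lattice _ (if s.1 p = 0 then 0 else 1 : ℤ)

theorem wedge_mem_latticeEnd (p : P) : wedge p ∈ latticeEnd P :=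
  mem_latticeEnd_of_single fun s => by
    rw [wedge, shift_single, one_mul]
    have h := single_intCast_mem_lattice (s.1, insert p s.2)
      (if p ∈ s.2 then 0 else (-1) ^ (s.2.filter (· < p)).card : ℤ)
    push_cast at h
    exact h

theorem contr_mem_latticeEnd (p : P) : contr p ∈ latticeEnd P :=
  mem_latticeEnd_of_single fun s => by
    rw [contr, shift_single, one_mul]
    have h := single_intCast_mem_lattice (s.1, s.2.erase p)
      (if p ∈ s.2 then (-1) ^ (s.2.filter (· < p)).card else 0 : ℤ)
    push_cast at h
    exact h

theorem up_pow_single (p : P) (k : ℕ) (s : State P) :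
    (up p ^ k) (Finsupp.single s 1) = Finsupp.single (Function.update s.1 p (s.1 p + k), s.2)
      (((s.1 p + 1).ascFactorial k : ℕ) : ℚ) := by
  induction k with
  | zero => simp
  | succ k ih =>
    rw [pow_succ', Module.End.mul_apply, ih, up, shift_single]
    simp only [Function.update_self, Function.update_idem, Nat.ascFactorial_succ]
    congr 1
    push_cast
    ring

theorem HasDividedPowers.up (p : P) : HasDividedPowers (up p) := by
  intro k
  refine mem_latticeEnd_of_single fun s => ?_
  -- On divided power monomials, t^(k) t^(a) = C(a+k, k) t^(a+k).
  rw [LinearMap.smul_apply, up_pow_single, Nat.ascFactorial_eq_factorial_mul_choose,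
    Finsupp.smul_single, smul_eq_mul, Nat.cast_mul, inv_mul_cancel_left₀ (by positivity)]
  exact_mod_cast single_intCast_mem_lattice _ (((s.1 p + k).choose k : ℕ) : ℤ)

/-- The denominator k! is absorbed entirely by the power of `up p`; powers of `down q` already
preserve the lattice. -/
theorem HasDividedPowers.up_mul_down {p q : P} (h : p ≠ q) :
    HasDividedPowers (Queer.up p * down q) := by
  intro k
  have hc : Commute (Queer.up p) (down q) := by
    simp [Commute, SemiconjBy, down_up, h.symm]
  rw [hc.mul_pow, ← smul_mul_assoc]
  exact mul_mem (HasDividedPowers.up p k) (pow_mem (down_mem_latticeEnd q) k)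

theorem HasDividedPowers.wedge_mul_contr {p q : P} (h : p ≠ q) :
    HasDividedPowers (wedge p * contr q) := by
  refine .of_mul_self (mul_mem (wedge_mem_latticeEnd p) (contr_mem_latticeEnd q)) ?_
  have h0 : wedge p * wedge p = 0 := by
    refine end_ext fun s => ?_
    simp [wedge, shift_single]
  have h1 : contr q * wedge p = - (wedge p * contr q) := by simp [contr_wedge, h.symm]
  exact mul_mul_self_eq_zero_of_anticommute h0 h1

end Lattice

section Falling

variable {A : Type*} [Ring A]

/-- The falling factorial `T (T - 1) ⋯ (T - k + 1)`. -/
def falling (T : A) (k : ℕ) : A := ((List.range k).map fun t : ℕ => T - (t : A)).prod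

theorem falling_succ (T : A) (k : ℕ) : falling T (k + 1) = falling T k * (T - k) := by
  simp [falling, List.range_succ]

theorem commute_falling (T : A) (k : ℕ) : Commute T (falling T k) := by
  induction k with
  | zero => simp [falling]
  | succ k ih =>
    rw [falling_succ]
    exact ih.mul_right ((Commute.refl T).sub_right (Nat.cast_commute k T).symm)

theorem falling_succ' (T : A) (k : ℕ) : falling T (k + 1) = (T - k) * falling T k := by
  rw [falling_succ]
  exact (((commute_falling T k).sub_left (Nat.cast_commute k _)).eq).symm

theorem mul_pow_of_raising {N t : A} (h : N * t = t * N + t) (a : ℕ) :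
    N * t ^ a = t ^ a * (N + a) := by
  induction a with
  | zero => simp
  | succ a ih =>
    rw [pow_succ, ← mul_assoc, ih, mul_assoc, mul_assoc, add_mul, h, (Nat.cast_commute a t).eq]
    push_cast
    noncomm_ring

/-- A Vandermonde identity for an operator N that raises t by one. Moving N past t^i adds i, so the
factor N - k, with k = i + j, becomes N - j, which is the next factor of the falling factorial of N.
-/
theorem falling_add {N t : A} (h : N * t = t * N + t) (k : ℕ) :
    falling (t + N) k
      = ∑ ij ∈ Finset.HasAntidiagonal.antidiagonal k, k.choose ij.1 • (t ^ ij.1 * falling N ij.2) := by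
  induction k with
  | zero => simp [falling]
  | succ k ih =>
    rw [falling_succ', ih,
      Finset.sum_antidiagonal_choose_succ_nsmul (fun i j => t ^ i * falling N j) k,
      Finset.mul_sum, ← Finset.sum_add_distrib]
    refine Finset.sum_congr rfl fun ij hij => ?_
    have hk := Finset.HasAntidiagonal.mem_antidiagonal.1 hij
    have hs : k.choose ij.2 = k.choose ij.1 := by
      rw [← hk, Nat.add_comm, ← Nat.choose_symm_add, Nat.add_comm]
    rw [hs, mul_smul_comm, ← smul_add]
    congr 1
    rw [falling_succ' N ij.2, ← mul_assoc, sub_mul, add_mul, mul_pow_of_raising h, pow_succ', ← hk,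
      (Nat.cast_commute (ij.1 + ij.2) (t ^ ij.1)).eq]
    push_cast
    noncomm_ring

end Falling

end

/-! ### The Kostant form preserves the lattice -/

section

theorem IsWeylClifford.commute_td {R : Type*} [Ring R] {n : ℕ} {t d ξ δ : Fin n → Fin n → R}
    (H : IsWeylClifford t d ξ δ) {i j : Fin n} (h : i ≠ j) (l m : Fin n) :
    Commute (t i l) (d j m) := by
  rw [Commute, SemiconjBy, H.dt]; simp [h.symm]

theorem IsWeylClifford.contr_wedge_of_ne {R : Type*} [Ring R] {n : ℕ}
    {t d ξ δ : Fin n → Fin n → R} (H : IsWeylClifford t d ξ δ) {i j : Fin n} (h : i ≠ j)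
    (l m : Fin n) : δ j l * ξ i m = -(ξ i m * δ j l) := by
  rw [H.δξ]; simp [h.symm]

variable {n : ℕ}

/-- The operator is a sum of t_ij, the t_il d_jl and the ξ_il δ_jl. All variables have row i and all
derivatives row j ≠ i, so the summands commute pairwise, and each has integral divided powers. -/
theorem HasDividedPowers.fockE {i j : Fin n} (h : i ≠ j) : HasDividedPowers (fockE i j) := by
  have H := isWeylClifford_fock n
  have hp : ∀ l : Fin n, toLex (i, l) ≠ toLex (j, l) := fun l => by simp [h]
  rw [Queer.fockE, IsWeylClifford.evenOp, IsWeylClifford.evenDer, Finset.sum_add_distrib]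
  refine .add (.up _) (.add (.sum _ _ (fun l _ => .up_mul_down (hp l)) fun l _ m _ => ?_)
    (.sum _ _ (fun l _ => .wedge_mul_contr (hp l)) fun l _ m _ => ?_) ?_) ?_
  · exact .mul_left (.mul_right (H.tt i l i m) (H.commute_td h l m))
      (.mul_right (H.commute_td h m l).symm (H.dd j l j m))
  · refine commute_mul_mul_of_anticommute (H.ξξ i l i m) ?_ (H.contr_wedge_of_ne h l m)
      (H.δδ j l j m)
    have := H.contr_wedge_of_ne h m l
    exact (neg_eq_iff_eq_neg.2 this).symm
  · refine .sum_left _ _ _ fun l _ => .sum_right _ _ _ fun m _ => ?_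
    exact .mul_left (.mul_right (H.ξt i m i l).symm (H.δt j m i l).symm)
      (.mul_right (H.ξd i m j l).symm (H.δd j m j l).symm)
  · refine .add_right (.sum_right _ _ _ fun l _ => ?_) (.sum_right _ _ _ fun l _ => ?_)
    · exact .mul_right (H.tt i j i l) (H.commute_td h j l)
    · exact .mul_right (H.ξt i l i j).symm (H.δt j l i j).symm

theorem fockO_mem_latticeEnd (i j : Fin n) : fockO i j ∈ latticeEnd (Fin n ×ₗ Fin n) := by
  refine add_mem (wedge_mem_latticeEnd _) (sum_mem fun l _ => add_mem ?_ ?_)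
  · exact mul_mem (wedge_mem_latticeEnd _) (down_mem_latticeEnd _)
  · exact mul_mem (up_mem_latticeEnd _) (contr_mem_latticeEnd _)

theorem falling_apply_of_eigenvector {P : Type*} {N : Module.End ℚ (Fock P)} {v : Fock P} {m : ℕ}
    (h : N v = (m : ℚ) • v) (k : ℕ) : falling N k v = (m.descFactorial k : ℚ) • v := by
  induction k with
  | zero => simp [falling]
  | succ k ih =>
    have e : (N - (k : Module.End ℚ (Fock P))) v = ((m : ℚ) - k) • v := by
      rw [LinearMap.sub_apply, h, Module.End.natCast_apply, sub_smul, Nat.cast_smul_eq_nsmul ℚ k]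
    rw [falling_succ', Module.End.mul_apply, ih, map_smul, e, smul_smul, Nat.descFactorial_succ]
    congr 1
    rcases le_or_gt k m with hk | hk
    · rw [Nat.cast_mul, Nat.cast_sub hk, mul_comm]
    · simp [Nat.descFactorial_eq_zero_iff_lt.2 hk]

section Number

variable {P : Type*} [LinearOrder P]

theorem up_down_single (p : P) (s : State P) :
    (up p * down p) (Finsupp.single s 1) = ((s.1 p : ℕ) : ℚ) • Finsupp.single s 1 := by
  rcases Nat.eq_zero_or_pos (s.1 p) with h0 | h0
  · simp [up, down, shift_single, h0]
  · have e : s.1 p - 1 + 1 = s.1 p := by omega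
    have e' : ((s.1 p - 1 : ℕ) : ℚ) + 1 = s.1 p := by exact_mod_cast e
    simp [up, down, shift_single, e, e', h0.ne']

theorem wedge_contr_single (p : P) (s : State P) :
    (wedge p * contr p) (Finsupp.single s 1)
      = ((if p ∈ s.2 then 1 else 0 : ℕ) : ℚ) • Finsupp.single s 1 := by
  by_cases hp : p ∈ s.2 <;>
    simp [wedge, contr, shift_single, hp, sgn_erase, sgn_mul_self]

end Number

/-- Here h_i acts as t_ii + N, where N counts the variables of row i and raises t_ii by one. Hence
binom(h_i, k) acts as the sum of the t_ii^(a) binom(N, b) with a + b = k, and N is diagonal with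
natural eigenvalues. -/
theorem falling_fockE_mem_latticeEnd (i : Fin n) (k : ℕ) :
    ((k.factorial : ℚ)⁻¹) • falling (fockE i i) k ∈ latticeEnd (Fin n ×ₗ Fin n) := by
  have H := isWeylClifford_fock n
  rw [fockE, IsWeylClifford.evenOp, falling_add (by simpa using H.evenDer_t i i i i),
    Finset.smul_sum]
  refine sum_mem fun ij hij => ?_
  obtain rfl := Finset.HasAntidiagonal.mem_antidiagonal.1 hij
  set N := IsWeylClifford.evenDer (fun i j : Fin n => up (toLex (i, j)))
    (fun i j => down (toLex (i, j))) (fun i j => wedge (toLex (i, j)))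
    (fun i j => contr (toLex (i, j))) i i with hN
  rw [inv_factorial_smul_choose_smul]
  refine mul_mem (HasDividedPowers.up _ _) (mem_latticeEnd_of_single fun s => ?_)
  have hs : N (Finsupp.single s 1) = ((∑ l : Fin n, (s.1 (toLex (i, l))
      + if toLex (i, l) ∈ s.2 then 1 else 0) : ℕ) : ℚ) • Finsupp.single s 1 := by
    rw [hN, IsWeylClifford.evenDer, LinearMap.sum_apply, Nat.cast_sum, Finset.sum_smul]
    refine Finset.sum_congr rfl fun l _ => ?_
    rw [LinearMap.add_apply, up_down_single, wedge_contr_single, Nat.cast_add, add_smul]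
  rw [LinearMap.smul_apply, falling_apply_of_eigenvector hs, Nat.descFactorial_eq_factorial_mul_choose,
    smul_smul, Nat.cast_mul, inv_mul_cancel_left₀ (by positivity), Finsupp.smul_single, smul_eq_mul,
    mul_one]
  exact_mod_cast single_intCast_mem_lattice s (((_ : ℕ).choose ij.2 : ℕ) : ℤ)

theorem UZ_le_comap_latticeEnd (n : ℕ) :
    UZ n ≤ (latticeEnd (Fin n ×ₗ Fin n)).comap ((fockRep n : U n →+* _).toIntAlgHom) := by
  have hE : ∀ (i j : Fin n) (k : ℕ), i ≠ j →
      fockRep n (divPow (x i j) k) ∈ latticeEnd (Fin n ×ₗ Fin n) := by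
    intro i j k h
    rw [divPow, map_smul, map_pow, fockRep_x]
    exact HasDividedPowers.fockE h k
  have hO : ∀ i j : Fin n, fockRep n (xbar i j) ∈ latticeEnd (Fin n ×ₗ Fin n) := by
    intro i j
    rw [fockRep_xbar]
    exact fockO_mem_latticeEnd i j
  refine Algebra.adjoin_le ?_
  rintro u ((hu | hu) | hu)
  · obtain ⟨i, j, hij, ⟨k, rfl⟩ | rfl⟩ := hu
    · exact hE i j k (by rintro rfl; omega)
    · exact hO i j
  · obtain ⟨i, j, hij, ⟨k, rfl⟩ | rfl⟩ := hu
    · exact hE j i k (by rintro rfl; omega)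
    · exact hO j i
  · obtain ⟨i, ⟨k, rfl⟩ | rfl⟩ := hu
    · have e : fockRep n (binom (h i) k) = ((k.factorial : ℚ)⁻¹) • falling (fockE i i) k := by
        rw [binom, map_smul, map_list_prod, List.map_map, falling, ← fockRep_x]
        congr 3
        funext t
        simp [h, x]
      change fockRep n (binom (h i) k) ∈ latticeEnd (Fin n ×ₗ Fin n)
      rw [e]
      exact falling_fockE_mem_latticeEnd i k
    · exact hO i i

end

/-! ### Words in the units, and straightening modulo shorter words -/

section

variable {n : ℕ}

/-- Labels of the basis of `𝔮(n)`; `false` marks the even and `true` the odd units. -/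
abbrev Label (n : ℕ) : Type := (Fin n × Fin n) × Bool

/-- The generator of `U(𝔮(n))` with the given label. -/
def gen (g : Label n) : U n := if g.2 then xbar g.1.1 g.1.2 else x g.1.1 g.1.2

/-- The product of the generators along a list of labels. -/
def word (l : List (Label n)) : U n := (l.map gen).prod

theorem word_append (l l' : List (Label n)) : word (l ++ l') = word l * word l' := by simp [word]

theorem word_cons (g : Label n) (l : List (Label n)) : word (g :: l) = gen g * word l := by
  simp [word]

/-- All labels of the list are positions in the relation `r`. -/
def Inside (r : Fin n → Fin n → Prop) (l : List (Label n)) : Prop := ∀ g ∈ l, r g.1.1 g.1.2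

/-- The span of the words of length less than `d` with labels in `r`. -/
def shorter (r : Fin n → Fin n → Prop) (d : ℕ) : Submodule ℚ (U n) :=
  Submodule.span ℚ {u | ∃ l, Inside r l ∧ l.length < d ∧ word l = u}

variable {r : Fin n → Fin n → Prop}

theorem word_mem_shorter {l : List (Label n)} (hl : Inside r l) {d : ℕ} (h : l.length < d) :
    word l ∈ shorter r d :=
  Submodule.subset_span ⟨l, hl, h, rfl⟩

theorem shorter_mono {d d' : ℕ} (h : d ≤ d') : shorter r d ≤ shorter r d' :=
  Submodule.span_mono fun _ ⟨l, hl, hd, e⟩ => ⟨l, hl, hd.trans_le h, e⟩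

/-- The bounds are strict: lengths at most a - 1 and b - 1 add up to at most a + b - 2. Later length
counts rely on the unit gained. -/
theorem shorter_mul_shorter_le (a b : ℕ) : shorter r a * shorter r b ≤ shorter r (a + b - 1) := by
  rw [shorter, shorter, Submodule.span_mul_span, Submodule.span_le]
  rintro _ ⟨_, ⟨l, hl, ha, rfl⟩, _, ⟨l', hl', hb, rfl⟩, rfl⟩
  change word l * word l' ∈ shorter r _
  rw [← word_append]
  refine word_mem_shorter (fun g hg => ?_) (by rw [List.length_append]; omega)
  exact (List.mem_append.1 hg).elim (hl g) (hl' g)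

theorem mul_mem_shorter {u v : U n} {a b c : ℕ} (hu : u ∈ shorter r a) (hv : v ∈ shorter r b)
    (h : a + b ≤ c + 1) : u * v ∈ shorter r c :=
  shorter_mono (by omega) (shorter_mul_shorter_le a b (Submodule.mul_mem_mul hu hv))

theorem gen_mem_shorter {g : Label n} (hg : r g.1.1 g.1.2) : gen g ∈ shorter r 2 := by
  have : gen g = word [g] := by simp [word]
  rw [this]
  exact word_mem_shorter (by simpa [Inside] using hg) (by simp)

/-- The bracket of two units has length one, and transitivity of `r` keeps its positions inside `r`.
The scalar is the sign of the superbracket. -/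
theorem exists_gen_mul_gen_sub_mem (hr : ∀ i j k, r i j → r j k → r i k) {g g' : Label n}
    (hg : r g.1.1 g.1.2) (hg' : r g'.1.1 g'.1.2) :
    ∃ ε : ℚ, gen g * gen g' - ε • (gen g' * gen g) ∈ shorter r 2 := by
  obtain ⟨⟨i, j⟩, b⟩ := g
  obtain ⟨⟨k, l⟩, b'⟩ := g'
  have hx : ∀ {i j}, r i j → (x i j : U n) ∈ shorter r 2 := fun {i j} h =>
    gen_mem_shorter (g := ((i, j), false)) h
  have hxb : ∀ {i j}, r i j → (xbar i j : U n) ∈ shorter r 2 := fun {i j} h =>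
    gen_mem_shorter (g := ((i, j), true)) h
  have e1 : ∀ f : Fin n → Fin n → U n, (∀ i j, r i j → f i j ∈ shorter r 2) →
      (if j = k then f i l else 0) ∈ shorter r 2 := by
    intro f hf
    split_ifs with h
    · subst h; exact hf _ _ (hr _ _ _ hg hg')
    · exact zero_mem _
  have e2 : ∀ f : Fin n → Fin n → U n, (∀ i j, r i j → f i j ∈ shorter r 2) →
      (if l = i then f k j else 0) ∈ shorter r 2 := by
    intro f hf
    split_ifs with h
    · subst h; exact hf _ _ (hr _ _ _ hg' hg)
    · exact zero_mem _
  rcases b <;> rcases b'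
  · refine ⟨1, ?_⟩
    have := sub_mem (e1 x fun i j h => hx h) (e2 x fun i j h => hx h)
    simp only [gen, Bool.false_eq_true, if_false, x_mul_x i j k l, one_smul]
    convert this using 1; abel
  · refine ⟨1, ?_⟩
    have := sub_mem (e1 xbar fun i j h => hxb h) (e2 xbar fun i j h => hxb h)
    simp only [gen, Bool.false_eq_true, if_false, if_true, x_mul_xbar i j k l, one_smul]
    convert this using 1; abel
  · refine ⟨1, ?_⟩
    have := sub_mem (e1 xbar fun i j h => hxb h) (e2 xbar fun i j h => hxb h)
    simp only [gen, Bool.false_eq_true, if_false, if_true, x_mul_xbar k l i j, one_smul]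
    convert this using 1; abel
  · refine ⟨-1, ?_⟩
    have := add_mem (e1 x fun i j h => hx h) (e2 x fun i j h => hx h)
    simp only [gen, if_true, xbar_mul_xbar i j k l, neg_smul, one_smul]
    convert this using 1; abel

/-- The square of an odd element is half its superbracket with itself, so it is zero off the
diagonal and h_i on it. -/
theorem xbar_mul_self (i j : Fin n) : (xbar i j * xbar i j : U n) = if i = j then x i j else 0 := by
  have h := xbar_mul_xbar i j i j
  have h2 : (2 : ℚ) • (xbar i j * xbar i j : U n) = (2 : ℚ) • if i = j then x i j else 0 := by
    rw [two_smul, two_smul]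
    nth_rewrite 1 [h]
    by_cases hij : i = j
    · subst hij; simp; abel
    · simp [hij, Ne.symm hij]
  exact smul_right_injective _ (two_ne_zero' ℚ) h2

theorem gen_odd_mul_self_mem {g : Label n} (hg : r g.1.1 g.1.2) (hodd : g.2 = true) :
    gen g * gen g ∈ shorter r 2 := by
  obtain ⟨⟨i, j⟩, b⟩ := g
  obtain rfl : b = true := hodd
  simp only [gen, if_true, xbar_mul_self]
  split_ifs
  · exact gen_mem_shorter (g := ((i, j), false)) hg
  · exact zero_mem _

theorem Inside.of_cons {g : Label n} {l : List (Label n)} (h : Inside r (g :: l)) : Inside r l :=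
  fun g' hg' => h g' (List.mem_cons_of_mem _ hg')

theorem exists_word_sub_mem_of_perm (hr : ∀ i j k, r i j → r j k → r i k)
    {l l' : List (Label n)} (h : l.Perm l') (hl : Inside r l) :
    ∃ ε : ℚ, word l - ε • word l' ∈ shorter r l.length := by
  induction h with
  | nil => exact ⟨1, by simp⟩
  | @cons g l l' _ ih =>
    obtain ⟨ε, he⟩ := ih hl.of_cons
    refine ⟨ε, ?_⟩
    rw [word_cons, word_cons, ← mul_smul_comm, ← mul_sub]
    exact mul_mem_shorter (gen_mem_shorter (hl g (by simp))) he (by simp; omega)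
  | swap g g' l =>
    obtain ⟨ε, he⟩ := exists_gen_mul_gen_sub_mem hr (hl g' (by simp)) (hl g (by simp))
    refine ⟨ε, ?_⟩
    rw [word_cons, word_cons, word_cons, word_cons, ← mul_assoc, ← mul_assoc, ← smul_mul_assoc,
      ← sub_mul]
    exact mul_mem_shorter he (word_mem_shorter hl.of_cons.of_cons (Nat.lt_succ_self _))
      (by simp; omega)
  | @trans l₁ l₂ l₃ h₁ h₂ ih₁ ih₂ =>
    obtain ⟨ε, he⟩ := ih₁ hl
    obtain ⟨ε', he'⟩ := ih₂ fun g hg => hl g (h₁.mem_iff.2 hg)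
    refine ⟨ε * ε', ?_⟩
    rw [← h₁.length_eq] at he'
    have := add_mem he (Submodule.smul_mem _ ε he')
    rwa [smul_sub, smul_smul, sub_add_sub_cancel] at this

/-- Bring two copies of the repeated odd letter to the front; their square has length at most one.
-/
theorem word_mem_shorter_of_two_le_count (hr : ∀ i j k, r i j → r j k → r i k)
    {l : List (Label n)} (hl : Inside r l) {g : Label n} (hodd : g.2 = true)
    (hg : 2 ≤ l.count g) : word l ∈ shorter r l.length := by
  have h1 : g ∈ l := List.count_pos_iff.1 (by omega)
  have p1 := List.perm_cons_erase h1
  have h2 : g ∈ l.erase g := List.count_pos_iff.1 (by rw [List.count_erase_self]; omega)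
  have p2 := p1.trans ((List.perm_cons_erase h2).cons g)
  obtain ⟨ε, he⟩ := exists_word_sub_mem_of_perm hr p2 hl
  have hi : Inside r (g :: g :: (l.erase g).erase g) := fun a ha => hl a (p2.mem_iff.2 ha)
  have h3 : word (g :: g :: (l.erase g).erase g) ∈ shorter r l.length := by
    rw [word_cons, word_cons, ← mul_assoc]
    refine mul_mem_shorter (gen_odd_mul_self_mem (hl g h1) hodd)
      (word_mem_shorter hi.of_cons.of_cons (Nat.lt_succ_self _)) ?_
    rw [p2.length_eq]; simp; omega
  have := add_mem he (Submodule.smul_mem _ ε h3)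
  rwa [sub_add_cancel] at this

/-- `u` is `c` times the word `l`, up to shorter words with labels in `r`. -/
def HasLeadingWord (r : Fin n → Fin n → Prop) (u : U n) (c : ℚ) (l : List (Label n)) : Prop :=
  Inside r l ∧ u - c • word l ∈ shorter r l.length

theorem HasLeadingWord.smul_word {l : List (Label n)} (hl : Inside r l) (c : ℚ) :
    HasLeadingWord r (c • word l) c l :=
  ⟨hl, by simp⟩

theorem HasLeadingWord.one : HasLeadingWord r 1 1 [] :=
  ⟨by simp [Inside], by simp [word]⟩

theorem HasLeadingWord.mul {u v : U n} {c d : ℚ} {l m : List (Label n)}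
    (hu : HasLeadingWord r u c l) (hv : HasLeadingWord r v d m) :
    HasLeadingWord r (u * v) (c * d) (l ++ m) := by
  refine ⟨fun g hg => (List.mem_append.1 hg).elim (hu.1 g) (hv.1 g), ?_⟩
  have hv' : v ∈ shorter r (m.length + 1) := by
    have := add_mem (shorter_mono (Nat.le_succ _) hv.2)
      (Submodule.smul_mem _ d (word_mem_shorter hv.1 (Nat.lt_succ_self _)))
    rwa [sub_add_cancel] at this
  have h1 : (u - c • word l) * v ∈ shorter r (l ++ m).length :=
    mul_mem_shorter hu.2 hv' (by simp; omega)
  have h2 : (c • word l) * (v - d • word m) ∈ shorter r (l ++ m).length :=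
    mul_mem_shorter (Submodule.smul_mem _ c (word_mem_shorter hu.1 (Nat.lt_succ_self _))) hv.2
      (by simp; omega)
  have := add_mem h1 h2
  rwa [sub_mul, mul_sub, sub_add_sub_cancel, smul_mul_smul_comm, ← word_append] at this

theorem HasLeadingWord.list_prod {α : Type*} (L : List α) (f : α → U n) (c : α → ℚ)
    (l : α → List (Label n)) (H : ∀ a ∈ L, HasLeadingWord r (f a) (c a) (l a)) :
    HasLeadingWord r (L.map f).prod (L.map c).prod (L.flatMap l) := by
  induction L with
  | nil => simpa using HasLeadingWord.one
  | cons a L ih =>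
    simp only [List.map_cons, List.prod_cons, List.flatMap_cons]
    exact (H a (by simp)).mul (ih fun b hb => H b (by simp [hb]))

/-- The alternative k = 0 covers absent factors: a position outside `r` is harmless when its
exponent vanishes. -/
theorem inside_replicate {g : Label n} {k : ℕ} (h : r g.1.1 g.1.2 ∨ k = 0) :
    Inside r (List.replicate k g) := by
  intro g' hg'
  obtain ⟨hk, rfl⟩ := List.mem_replicate.1 hg'
  exact h.resolve_right hk

theorem HasLeadingWord.xbar_pow {i j : Fin n} {k : ℕ} (h : r i j ∨ k = 0) :
    HasLeadingWord r (xbar i j ^ k) 1 (List.replicate k ((i, j), true)) := by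
  have e : (xbar i j ^ k : U n) = (1 : ℚ) • word (List.replicate k ((i, j), true)) := by
    simp [word, gen]
  rw [e]
  exact .smul_word (inside_replicate h) _

theorem HasLeadingWord.divPow {i j : Fin n} {k : ℕ} (h : r i j ∨ k = 0) :
    HasLeadingWord r (divPow (x i j) k) (k.factorial : ℚ)⁻¹
      (List.replicate k ((i, j), false)) := by
  have e : (Queer.divPow (x i j) k : U n)
      = (k.factorial : ℚ)⁻¹ • word (List.replicate k ((i, j), false)) := by
    simp [word, gen, Queer.divPow]
  rw [e]
  exact .smul_word (inside_replicate h) _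

theorem HasLeadingWord.binom {i : Fin n} {k : ℕ} (hi : r i i ∨ k = 0) :
    HasLeadingWord r (binom (h i) k) (k.factorial : ℚ)⁻¹
      (List.replicate k ((i, i), false)) := by
  have e := HasLeadingWord.list_prod (r := r) (List.range k) (fun t : ℕ => h i - (t : U n))
    (fun _ => 1) (fun _ => [((i, i), false)]) (by
      intro t ht
      have hr : r i i := hi.resolve_right (by rintro rfl; simp at ht)
      refine ⟨by simpa [Inside] using hr, ?_⟩
      -- The shift by t is a multiple of the empty word, hence of lower length.
      have e0 : h i - (t : U n) - (1 : ℚ) • word [((i, i), false)] = (-(t : ℚ)) • word [] := by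
        simp [word, gen, h, x, Algebra.smul_def]
      rw [e0]
      exact Submodule.smul_mem _ _ (word_mem_shorter (by simp [Inside]) (by simp)))
  have e1 : (List.range k).flatMap (fun _ => [(((i, i), false) : Label n)])
      = List.replicate k ((i, i), false) := by
    rw [← List.map_eq_flatMap, List.map_const']
    simp
  simp only [List.map_const', List.prod_replicate, one_pow, e1] at e
  refine ⟨e.1, ?_⟩
  have := Submodule.smul_mem _ ((k.factorial : ℚ)⁻¹) e.2
  rwa [one_smul, smul_sub] at this

end

/-! ### Monomials as words, and their rational span -/

section

theorem prod_map_filter {M α : Type*} [CommMonoid M] (l : List α) (p : α → Prop) [DecidablePred p]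
    (f : α → M) :
    ((l.filter fun a => p a).map f).prod = (l.map fun a => if p a then f a else 1).prod := by
  induction l with
  | nil => simp
  | cons a l ih =>
    by_cases h : p a <;> simp [h, ih]

theorem sum_map_filter {M α : Type*} [AddCommMonoid M] (l : List α) (p : α → Prop)
    [DecidablePred p] (f : α → M) :
    ((l.filter fun a => p a).map f).sum = (l.map fun a => if p a then f a else 0).sum :=
  prod_map_filter (M := Multiplicative M) l p f

attribute [to_additive existing] prod_map_filter

/-- Splitting a product over a square into the strictly lower, diagonal and strictly upper part. -/
@[to_additive]
theorem prod_triangular {M : Type*} [CommMonoid M] {n : ℕ} (F : Fin n → Fin n → M) :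
    ((List.finRange n).map fun j =>
        (((List.finRange n).filter fun k => j < k).reverse.map fun k => F k j).prod).prod
      * ((List.finRange n).map fun i => F i i).prod
      * ((List.finRange n).reverse.map fun j =>
        (((List.finRange n).filter fun k => j < k).map fun k => F j k).prod).prod
      = ∏ i, ∏ j, F i j := by
  simp only [List.map_reverse, List.prod_reverse, prod_map_filter, ← Fin.prod_univ_def]
  rw [Finset.prod_comm, ← Finset.prod_mul_distrib, ← Finset.prod_mul_distrib]
  refine Finset.prod_congr rfl fun i _ => ?_
  have e : F i i = ∏ j, if j = i then F i j else 1 := by simp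
  rw [e, ← Finset.prod_mul_distrib, ← Finset.prod_mul_distrib]
  refine Finset.prod_congr rfl fun j _ => ?_
  rcases lt_trichotomy i j with h | h | h
  · simp [h, h.ne', h.not_gt]
  · simp [h]
  · simp [h, h.ne, h.not_gt]

variable {n : ℕ} {r : Fin n → Fin n → Prop}

/-- The entries of `A` at the positions outside `r` vanish. -/
def SupportedOn (r : Fin n → Fin n → Prop) (A : SuperMat n) : Prop :=
  ∀ i j, ¬ r i j → A.1 i j = 0 ∧ A.2 i j = 0

/-- The labels of the factor `rootFactor A i j`. -/
def rootWord (A : SuperMat n) (i j : Fin n) : List (Label n) :=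
  List.replicate (A.1 i j) ((i, j), false) ++ List.replicate (A.2 i j : ℕ) ((i, j), true)

/-- The labels of the factors of `monomial A`. -/
def monomialWord (A : SuperMat n) : List (Label n) :=
  ((List.finRange n).flatMap fun j =>
      ((List.finRange n).filter fun k => j < k).reverse.flatMap fun k => rootWord A k j)
    ++ ((List.finRange n).flatMap fun i => List.replicate (A.1 i i) ((i, i), false))
    ++ ((List.finRange n).flatMap fun i => List.replicate (A.2 i i : ℕ) ((i, i), true))
    ++ (List.finRange n).reverse.flatMap fun j =>
      ((List.finRange n).filter fun k => j < k).flatMap fun k => rootWord A j k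

theorem coe_flatMap {α β : Type*} (l : List α) (f : α → List β) :
    ((l.flatMap f : List β) : Multiset β) = (l.map fun a => (f a : Multiset β)).sum := by
  induction l with
  | nil => simp
  | cons a l ih => rw [List.flatMap_cons, ← Multiset.coe_add, ih]; simp

theorem sum_map_add' {M α : Type*} [AddCommMonoid M] (l : List α) (f g : α → M) :
    (l.map f).sum + (l.map g).sum = (l.map fun a => f a + g a).sum := by
  induction l with
  | nil => simp
  | cons a l ih => simp only [List.map_cons, List.sum_cons, ← ih]; abel

/-- Forgetting the order of letters suffices, since straightening works up to permutation. -/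
theorem coe_monomialWord (A : SuperMat n) :
    (monomialWord A : Multiset (Label n)) = ∑ i, ∑ j, (rootWord A i j : Multiset (Label n)) := by
  rw [← sum_triangular, monomialWord, ← Multiset.coe_add, ← Multiset.coe_add, ← Multiset.coe_add]
  simp only [coe_flatMap]
  congr 1
  rw [add_assoc, sum_map_add']
  rfl

theorem count_rootWord (A : SuperMat n) (i j : Fin n) (g : Label n) :
    (rootWord A i j).count g
      = if g.1 = (i, j) then (if g.2 then (A.2 i j : ℕ) else A.1 i j) else 0 := by
  obtain ⟨p, b⟩ := g
  by_cases hp : p = (i, j)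
  · subst hp
    rcases b <;> simp [rootWord, List.count_replicate]
  · have hp' : (i, j) ≠ p := Ne.symm hp
    simp [rootWord, List.count_replicate, hp, hp']

theorem count_coe_label (l : List (Label n)) (g : Label n) :
    (l : Multiset (Label n)).count g = l.count g := by
  induction l with
  | nil => simp
  | cons a l ih =>
    rw [← Multiset.cons_coe, Multiset.count_cons, List.count_cons, ih]
    simp [eq_comm (a := g)]

theorem count_monomialWord (A : SuperMat n) (g : Label n) :
    (monomialWord A).count g = if g.2 then (A.2 g.1.1 g.1.2 : ℕ) else A.1 g.1.1 g.1.2 := by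
  rw [← count_coe_label, coe_monomialWord, Multiset.count_sum']
  simp only [Multiset.count_sum', count_coe_label, count_rootWord]
  obtain ⟨⟨i, j⟩, b⟩ := g
  simp [Prod.ext_iff, ite_and]

theorem length_monomialWord (A : SuperMat n) :
    (monomialWord A).length = ∑ i, ∑ j, (A.1 i j + (A.2 i j : ℕ)) := by
  rw [← Multiset.coe_card, coe_monomialWord]
  simp [rootWord]

/-- The coefficient of the leading word of `monomial A`. -/
def leadingCoeff (A : SuperMat n) : ℚ := ∏ i, ∏ j, ((A.1 i j).factorial : ℚ)⁻¹

theorem leadingCoeff_ne_zero (A : SuperMat n) : leadingCoeff A ≠ 0 :=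
  Finset.prod_ne_zero_iff.2 fun i _ => Finset.prod_ne_zero_iff.2 fun j _ => by positivity

theorem SupportedOn.hasLeadingWord_rootFactor {A : SuperMat n} (hA : SupportedOn r A)
    (i j : Fin n) :
    HasLeadingWord r (rootFactor A i j) ((A.1 i j).factorial : ℚ)⁻¹ (rootWord A i j) := by
  have h1 : r i j ∨ A.1 i j = 0 := or_iff_not_imp_left.2 fun h => (hA i j h).1
  have h2 : r i j ∨ (A.2 i j : ℕ) = 0 := or_iff_not_imp_left.2 fun h => by simp [(hA i j h).2]
  have := (HasLeadingWord.divPow h1).mul (.xbar_pow h2)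
  rwa [mul_one] at this

theorem SupportedOn.hasLeadingWord_monomial {A : SuperMat n} (hA : SupportedOn r A) :
    HasLeadingWord r (monomial A) (leadingCoeff A) (monomialWord A) := by
  have hm := HasLeadingWord.list_prod (List.finRange n) _ _ _ fun j _ =>
    HasLeadingWord.list_prod ((List.finRange n).filter fun k => j < k).reverse _ _ _ fun k _ =>
      hA.hasLeadingWord_rootFactor k j
  have hp := HasLeadingWord.list_prod (List.finRange n).reverse _ _ _ fun j _ =>
    HasLeadingWord.list_prod ((List.finRange n).filter fun k => j < k) _ _ _ fun k _ =>
      hA.hasLeadingWord_rootFactor j k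
  have h0 := HasLeadingWord.list_prod (r := r) (List.finRange n) _ _ _ fun i _ =>
    HasLeadingWord.binom (i := i) (k := A.1 i i)
      (or_iff_not_imp_left.2 fun h => (hA i i h).1)
  have h1 := HasLeadingWord.list_prod (r := r) (List.finRange n) _ _ _ fun i _ =>
    HasLeadingWord.xbar_pow (i := i) (j := i) (k := (A.2 i i : ℕ))
      (or_iff_not_imp_left.2 fun h => by simp [(hA i i h).2])
  have := ((hm.mul h0).mul h1).mul hp
  have e : (List.map (fun _ => (1 : ℚ)) (List.finRange n)).prod = 1 := by simp
  rw [e, mul_one, prod_triangular fun i j => ((A.1 i j).factorial : ℚ)⁻¹] at this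
  exact this

/-- Induction on length. A word with a repeated odd letter reduces to shorter words; any other word
is a permutation of the word of exactly one monomial, whose leading coefficient is invertible in ℚ.
-/
theorem shorter_le_span_monomial (hr : ∀ i j k, r i j → r j k → r i k) (d : ℕ) :
    shorter r d ≤ Submodule.span ℚ (monomial '' {A | SupportedOn r A}) := by
  induction d with
  | zero =>
    refine Submodule.span_le.2 ?_
    rintro _ ⟨l, -, hl, -⟩
    exact absurd hl (Nat.not_lt_zero _)
  | succ d ih =>
    refine Submodule.span_le.2 ?_
    rintro _ ⟨l, hl, hd, rfl⟩
    have hle : shorter r l.length ≤ Submodule.span ℚ (monomial '' {A | SupportedOn r A}) :=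
      (shorter_mono (Nat.lt_succ_iff.1 hd)).trans ih
    by_cases hodd : ∃ g : Label n, g.2 = true ∧ 2 ≤ l.count g
    · obtain ⟨g, hg, hc⟩ := hodd
      exact hle (word_mem_shorter_of_two_le_count hr hl hg hc)
    · push Not at hodd
      let A : SuperMat n := (fun i j => l.count ((i, j), false),
        fun i j => ⟨l.count ((i, j), true), hodd _ rfl⟩)
      have hA : SupportedOn r A := by
        intro i j hij
        have h0 : ∀ b, l.count ((i, j), b) = 0 := fun b =>
          List.count_eq_zero.2 fun hmem => hij (hl _ hmem)
        exact ⟨h0 false, Fin.ext (h0 true)⟩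
      have hp : l.Perm (monomialWord A) := by
        rw [List.perm_iff_count]
        rintro ⟨⟨i, j⟩, b⟩
        rw [count_monomialWord]
        rcases b <;> simp [A]
      obtain ⟨ε, he⟩ := exists_word_sub_mem_of_perm hr hp hl
      have h1 := hA.hasLeadingWord_monomial.2
      rw [← hp.length_eq] at h1
      have h2 : word (monomialWord A) ∈ Submodule.span ℚ (monomial '' {A | SupportedOn r A}) := by
        have h3 := sub_mem (Submodule.subset_span (Set.mem_image_of_mem monomial hA)) (hle h1)
        rw [sub_sub_cancel] at h3
        exact (Submodule.smul_mem_iff _ (leadingCoeff_ne_zero A)).1 h3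
      have := add_mem (hle he) (Submodule.smul_mem _ ε h2)
      rwa [sub_add_cancel] at this

end

/-! ### Degree filtration, leading terms and independence -/

section

section Degree

variable {P : Type*} [Fintype P]

/-- The degree of a monomial in the Fock space. -/
def deg (s : State P) : ℕ := ∑ p, s.1 p + s.2.card

/-- The span of the monomials of degree less than `d`. -/
def below (P : Type*) [Fintype P] (d : ℕ) : Submodule ℚ (Fock P) :=
  Submodule.span ℚ {v | ∃ s, deg s < d ∧ Finsupp.single s 1 = v}

theorem single_mem_below {s : State P} {d : ℕ} (hs : deg s < d) (c : ℚ) :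
    Finsupp.single s c ∈ below P d := by
  rw [← mul_one c, ← smul_eq_mul, ← Finsupp.smul_single]
  exact Submodule.smul_mem _ _ (Submodule.subset_span ⟨s, hs, rfl⟩)

theorem below_mono {d d' : ℕ} (h : d ≤ d') : below P d ≤ below P d' :=
  Submodule.span_mono fun _ ⟨s, hs, e⟩ => ⟨s, hs.trans_le h, e⟩

theorem deg_lt_of_mem_below {d : ℕ} {v : Fock P} (hv : v ∈ below P d) {s : State P}
    (hs : v s ≠ 0) : deg s < d := by
  contrapose! hs
  induction hv using Submodule.span_induction with
  | mem _ h =>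
    obtain ⟨s', hs', rfl⟩ := h
    exact Finsupp.single_eq_of_ne (by rintro rfl; omega)
  | zero => rfl
  | add v w _ _ hv hw => rw [Finsupp.add_apply, hv, hw, add_zero]
  | smul c v _ hv => rw [Finsupp.smul_apply, hv, smul_zero]

theorem apply_mem_below {T : Module.End ℚ (Fock P)} {d d' : ℕ}
    (H : ∀ s, deg s < d → T (Finsupp.single s 1) ∈ below P d') {v : Fock P} (hv : v ∈ below P d) :
    T v ∈ below P d' := by
  induction hv using Submodule.span_induction with
  | mem _ h => obtain ⟨s, hs, rfl⟩ := h; exact H s hs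
  | zero => simp
  | add v w _ _ hv hw => rw [map_add]; exact add_mem hv hw
  | smul c v _ hv => rw [map_smul]; exact Submodule.smul_mem _ _ hv

theorem below_zero : below P 0 = ⊥ := by
  rw [below, Submodule.span_eq_bot]
  rintro _ ⟨s, hs, -⟩
  exact absurd hs (Nat.not_lt_zero _)

variable [LinearOrder P]

theorem sum_update_succ (f : P → ℕ) (p : P) :
    ∑ q, Function.update f p (f p + 1) q = ∑ q, f q + 1 := by
  have e : Function.update f p (f p + 1) = f + Pi.single p 1 := by
    funext q
    rcases eq_or_ne q p with rfl | h <;> simp [*]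
  simp [e, Finset.sum_add_distrib]

theorem up_mem_below (p : P) {d : ℕ} {v : Fock P} (hv : v ∈ below P d) :
    up p v ∈ below P (d + 1) := by
  refine apply_mem_below (fun s hs => ?_) hv
  rw [up, shift_single]
  refine single_mem_below ?_ _
  simp only [deg, sum_update_succ] at hs ⊢
  omega

theorem wedge_mem_below (p : P) {d : ℕ} {v : Fock P} (hv : v ∈ below P d) :
    wedge p v ∈ below P (d + 1) := by
  refine apply_mem_below (fun s hs => ?_) hv
  rw [wedge, shift_single]
  refine single_mem_below ?_ _
  have := Finset.card_insert_le p s.2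
  simp only [deg] at hs ⊢
  omega

theorem down_mem_below (p : P) {d : ℕ} {v : Fock P} (hv : v ∈ below P (d + 1)) :
    down p v ∈ below P d := by
  refine apply_mem_below (fun s hs => ?_) hv
  rw [down, shift_single]
  by_cases h0 : s.1 p = 0
  · simp [h0]
  · refine single_mem_below ?_ _
    have h1 := sum_update_succ (Function.update s.1 p (s.1 p - 1)) p
    have h2 : s.1 p - 1 + 1 = s.1 p := by omega
    simp only [Function.update_self, Function.update_idem, h2, Function.update_eq_self] at h1
    simp only [deg] at hs ⊢
    omega

theorem contr_mem_below (p : P) {d : ℕ} {v : Fock P} (hv : v ∈ below P (d + 1)) :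
    contr p v ∈ below P d := by
  refine apply_mem_below (fun s hs => ?_) hv
  rw [contr, shift_single]
  by_cases h0 : p ∈ s.2
  · refine single_mem_below ?_ _
    have := Finset.card_erase_add_one h0
    simp only [deg] at hs ⊢
    omega
  · simp [h0]

end Degree

variable {n : ℕ}

/-- Every term removes one variable and creates one. The case d = 0 is separate because the lowering
lemmas start from d + 1. -/
theorem evenDer_mem_below (i j : Fin n) {d : ℕ} {v : Fock (Fin n ×ₗ Fin n)}
    (hv : v ∈ below _ d) :
    IsWeylClifford.evenDer (fun i j : Fin n => up (toLex (i, j))) (fun i j => down (toLex (i, j)))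
      (fun i j => wedge (toLex (i, j))) (fun i j => contr (toLex (i, j))) i j v ∈ below _ d := by
  rcases d with _ | d
  · rw [below_zero, Submodule.mem_bot] at hv
    simp [hv]
  · rw [IsWeylClifford.evenDer, LinearMap.sum_apply]
    exact sum_mem fun l _ => add_mem (up_mem_below _ (down_mem_below _ hv))
      (wedge_mem_below _ (contr_mem_below _ hv))

theorem oddDer_mem_below (i j : Fin n) {d : ℕ} {v : Fock (Fin n ×ₗ Fin n)}
    (hv : v ∈ below _ d) :
    IsWeylClifford.oddDer (fun i j : Fin n => up (toLex (i, j))) (fun i j => down (toLex (i, j)))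
      (fun i j => wedge (toLex (i, j))) (fun i j => contr (toLex (i, j))) i j v ∈ below _ d := by
  rcases d with _ | d
  · rw [below_zero, Submodule.mem_bot] at hv
    simp [hv]
  · rw [IsWeylClifford.oddDer, LinearMap.sum_apply]
    exact sum_mem fun l _ => add_mem (wedge_mem_below _ (down_mem_below _ hv))
      (up_mem_below _ (contr_mem_below _ hv))

/-- The leading part of the action of a generator: multiplication by the variable. -/
def creation (g : Label n) : Module.End ℚ (Fock (Fin n ×ₗ Fin n)) :=
  if g.2 then wedge (toLex g.1) else up (toLex g.1)

theorem creation_mem_below (g : Label n) {d : ℕ} {v : Fock (Fin n ×ₗ Fin n)}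
    (hv : v ∈ below _ d) : creation g v ∈ below _ (d + 1) := by
  unfold creation
  split_ifs
  · exact wedge_mem_below _ hv
  · exact up_mem_below _ hv

theorem fockRep_gen_sub_creation_mem_below (g : Label n) {d : ℕ} {v : Fock (Fin n ×ₗ Fin n)}
    (hv : v ∈ below _ d) : fockRep n (gen g) v - creation g v ∈ below _ d := by
  obtain ⟨⟨i, j⟩, b⟩ := g
  rcases b
  · have e : fockRep n (gen ((i, j), false)) v - creation ((i, j), false) v
        = IsWeylClifford.evenDer (fun i j : Fin n => up (toLex (i, j)))
          (fun i j => down (toLex (i, j))) (fun i j => wedge (toLex (i, j)))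
          (fun i j => contr (toLex (i, j))) i j v := by
      simp [gen, creation, fockRep_x, fockE, IsWeylClifford.evenOp]
    rw [e]
    exact evenDer_mem_below i j hv
  · have e : fockRep n (gen ((i, j), true)) v - creation ((i, j), true) v
        = IsWeylClifford.oddDer (fun i j : Fin n => up (toLex (i, j)))
          (fun i j => down (toLex (i, j))) (fun i j => wedge (toLex (i, j)))
          (fun i j => contr (toLex (i, j))) i j v := by
      simp [gen, creation, fockRep_xbar, fockO, IsWeylClifford.oddOp]
    rw [e]
    exact oddDer_mem_below i j hv

/-- The vacuum vector of the Fock space. -/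
def vacuum (n : ℕ) : Fock (Fin n ×ₗ Fin n) := Finsupp.single (0, ∅) 1

theorem creation_prod_mem_below (l : List (Label n)) :
    (l.map creation).prod (vacuum n) ∈ below _ (l.length + 1) := by
  induction l with
  | nil => exact single_mem_below (by simp [deg]) 1
  | cons g l ih =>
    rw [List.map_cons, List.prod_cons, Module.End.mul_apply]
    exact creation_mem_below g ih

theorem fockRep_word_sub_mem_below (l : List (Label n)) :
    fockRep n (word l) (vacuum n) - (l.map creation).prod (vacuum n) ∈ below _ l.length := by
  induction l with
  | nil => simp [word]
  | cons g l ih =>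
    rw [List.map_cons, List.prod_cons, Module.End.mul_apply, word_cons, map_mul,
      Module.End.mul_apply]
    have h1 : fockRep n (word l) (vacuum n) ∈ below _ (l.length + 1) := by
      have := add_mem (below_mono (Nat.le_succ _) ih) (creation_prod_mem_below l)
      rwa [sub_add_cancel] at this
    have h2 := add_mem (fockRep_gen_sub_creation_mem_below g h1) (creation_mem_below g ih)
    rwa [map_sub, sub_add_sub_cancel] at h2

theorem fockRep_mem_below {r : Fin n → Fin n → Prop} {d : ℕ} {u : U n} (hu : u ∈ shorter r d) :
    fockRep n u (vacuum n) ∈ below _ d := by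
  induction hu using Submodule.span_induction with
  | mem _ h =>
    obtain ⟨l, -, hl, rfl⟩ := h
    have := add_mem (below_mono (Nat.le_succ _) (fockRep_word_sub_mem_below l))
      (creation_prod_mem_below l)
    rw [sub_add_cancel] at this
    exact below_mono hl this
  | zero => simp
  | add v w _ _ hv hw => rw [map_add]; exact add_mem hv hw
  | smul c v _ hv => rw [map_smul]; exact Submodule.smul_mem _ _ hv

/-- The monomial of the Fock space with the exponents given by the multiplicities in `l`. -/
def wordState (l : List (Label n)) : State (Fin n ×ₗ Fin n) :=
  (fun p => l.count (ofLex p, false), Finset.univ.filter fun p => (ofLex p, true) ∈ l)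

/-- Multiplying ordinary powers of t in the divided power basis produces the factorials, and
reordering the odd variables produces the sign. Distinct odd letters keep the product from
vanishing. -/
theorem creation_prod_vacuum (l : List (Label n))
    (hl : ∀ p, l.count (p, true) ≤ 1) :
    ∃ ε : ℚ, (ε = 1 ∨ ε = -1) ∧ (l.map creation).prod (vacuum n)
      = Finsupp.single (wordState l)
        (ε * ∏ p : Fin n ×ₗ Fin n, ((l.count (ofLex p, false)).factorial : ℚ)) := by
  induction l with
  | nil =>
    refine ⟨1, Or.inl rfl, ?_⟩
    have e : wordState ([] : List (Label n)) = (0, ∅) := by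
      simp [wordState]; rfl
    simp [vacuum, e]
  | cons g l ih =>
    obtain ⟨ε, hε, ih⟩ := ih fun p => (List.count_le_count_cons).trans (hl p)
    rw [List.map_cons, List.prod_cons, Module.End.mul_apply, ih]
    obtain ⟨p, b⟩ := g
    rcases b
    · refine ⟨ε, hε, ?_⟩
      have e1 : wordState ((p, false) :: l)
          = (Function.update (wordState l).1 (toLex p) ((wordState l).1 (toLex p) + 1),
            (wordState l).2) := by
        refine Prod.ext (funext fun q => ?_) ?_
        · rcases eq_or_ne q (toLex p) with h | h
          · rw [h]; simp [wordState]
          · have h' : p ≠ ofLex q := fun e => h (by rw [e]; rfl)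
            simp [wordState, h, List.count_cons, h']
        · simp [wordState]
      have e2 : ∀ q : Fin n ×ₗ Fin n,
          ((((p, false) :: l).count (ofLex q, false)).factorial : ℚ)
            = (if q = toLex p then ((l.count (p, false) : ℕ) : ℚ) + 1 else 1)
              * ((l.count (ofLex q, false)).factorial : ℚ) := by
        intro q
        rcases eq_or_ne q (toLex p) with h | h
        · rw [h]; simp [Nat.factorial_succ]
        · have h' : p ≠ ofLex q := fun e => h (by rw [e]; rfl)
          simp [h, h']
      rw [creation, if_neg (by simp), up, shift_single, e1, Finset.prod_congr rfl fun q _ => e2 q,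
        Finset.prod_mul_distrib]
      congr 1
      simp [wordState]
      ring
    · have hp : (p, true) ∉ l := by
        have := hl p
        rw [List.count_cons_self] at this
        exact List.count_eq_zero.1 (by omega)
      refine ⟨ε * sgn (toLex p) (wordState l).2, ?_, ?_⟩
      · have h1 : sgn (toLex p) (wordState l).2 = 1 ∨ sgn (toLex p) (wordState l).2 = -1 :=
          neg_one_pow_eq_or ℚ _
        rcases hε with rfl | rfl <;> rcases h1 with h1 | h1 <;> simp [h1]
      · have e1 : wordState ((p, true) :: l)
            = ((wordState l).1, insert (toLex p) (wordState l).2) := by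
          refine Prod.ext (funext fun q => ?_) ?_
          · simp [wordState]
          · ext q
            have : ofLex q = p ↔ q = toLex p := Iff.rfl
            simp [wordState, this]
        have hp' : toLex p ∉ (wordState l).2 := by simpa [wordState] using hp
        rw [creation, if_pos rfl, wedge, shift_single, e1]
        simp only [hp', if_false]
        congr 1
        have e2 : ∀ q : Fin n ×ₗ Fin n, ((p, true) :: l).count (ofLex q, false)
            = l.count (ofLex q, false) := fun q => by simp
        simp only [e2]
        ring

/-- The monomial of the Fock space corresponding to a pair of matrices. -/
def stateOf (A : SuperMat n) : State (Fin n ×ₗ Fin n) :=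
  (fun p => A.1 (ofLex p).1 (ofLex p).2,
    Finset.univ.filter fun p => A.2 (ofLex p).1 (ofLex p).2 = 1)

theorem stateOf_injective : Function.Injective (stateOf (n := n)) := by
  intro A B hAB
  refine Prod.ext ?_ ?_
  · ext i j
    exact congrFun (congrArg Prod.fst hAB) (toLex (i, j))
  · have h2 := congrArg Prod.snd hAB
    ext i j
    have h3 := Finset.ext_iff.1 h2 (toLex (i, j))
    simp only [stateOf, Finset.mem_filter, Finset.mem_univ, true_and, ofLex_toLex] at h3
    have h4 : ∀ a b : Fin 2, (a = 1 ↔ b = 1) → (a : ℕ) = b := by decide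
    exact h4 _ _ h3

theorem stateOf_surjective : Function.Surjective (stateOf (n := n)) := by
  intro s
  refine ⟨(fun i j => s.1 (toLex (i, j)), fun i j => if toLex (i, j) ∈ s.2 then 1 else 0), ?_⟩
  refine Prod.ext rfl ?_
  ext p
  simp [stateOf]

theorem wordState_monomialWord (A : SuperMat n) : wordState (monomialWord A) = stateOf A := by
  refine Prod.ext (funext fun p => ?_) ?_
  · simp [wordState, stateOf, count_monomialWord]
  · ext p
    have h1 : (ofLex p, true) ∈ monomialWord A
        ↔ 0 < (monomialWord A).count (ofLex p, true) := List.count_pos_iff.symm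
    have h2 : ∀ a : Fin 2, 0 < (a : ℕ) ↔ a = 1 := by decide
    simp only [wordState, stateOf, Finset.mem_filter, Finset.mem_univ, true_and, h1,
      count_monomialWord, if_true, h2]

theorem deg_stateOf (A : SuperMat n) : deg (stateOf A) = (monomialWord A).length := by
  have h2 : ∀ a : Fin 2, (if a = 1 then 1 else 0) = (a : ℕ) := by decide
  rw [length_monomialWord, deg, stateOf, Finset.card_filter]
  simp only [h2]
  rw [← Finset.sum_add_distrib, ← Fintype.sum_prod_type']
  exact Fintype.sum_equiv ofLex _ _ fun p => rfl

/-- The image of the vacuum under `monomial A`. -/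
def monomialVec (A : SuperMat n) : Fock (Fin n ×ₗ Fin n) := fockRep n (monomial A) (vacuum n)

/-- The inverse factorials in the divided powers and binomials cancel those from expanding ordinary
powers in the divided power basis. The resulting coefficient ±1 is a unit of ℤ, which is what
integrality needs. -/
theorem monomialVec_leading (A : SuperMat n) :
    ∃ ε : ℤ, (ε = 1 ∨ ε = -1) ∧ monomialVec A - Finsupp.single (stateOf A) (ε : ℚ)
      ∈ below _ (deg (stateOf A)) := by
  have hA : SupportedOn (fun _ _ => True) A := fun i j h => absurd trivial h
  have h1 := fockRep_mem_below hA.hasLeadingWord_monomial.2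
  have h2 := fockRep_word_sub_mem_below (monomialWord A)
  obtain ⟨ε, hε, h3⟩ := creation_prod_vacuum (monomialWord A) fun p => by
    rw [count_monomialWord, if_pos rfl]
    omega
  rw [h3, wordState_monomialWord, ← deg_stateOf] at h2
  rw [← deg_stateOf, map_sub, map_smul, LinearMap.sub_apply, LinearMap.smul_apply] at h1
  have h4 := add_mem h1 (Submodule.smul_mem _ (leadingCoeff A) h2)
  rw [smul_sub, sub_add_sub_cancel, Finsupp.smul_single, smul_eq_mul] at h4
  have h5 : leadingCoeff A * (ε * ∏ p : Fin n ×ₗ Fin n,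
      (((monomialWord A).count (ofLex p, false)).factorial : ℚ)) = ε := by
    have e : ∏ p : Fin n ×ₗ Fin n, (((monomialWord A).count (ofLex p, false)).factorial : ℚ)
        = ∏ i, ∏ j, ((A.1 i j).factorial : ℚ) := by
      rw [← Fintype.prod_prod_type']
      refine Fintype.prod_equiv ofLex _ _ fun p => ?_
      rw [count_monomialWord]
      simp
    have h6 : ∏ i, ∏ j, ((A.1 i j).factorial : ℚ) ≠ 0 :=
      Finset.prod_ne_zero_iff.2 fun i _ => Finset.prod_ne_zero_iff.2 fun j _ => by positivity
    rw [e, leadingCoeff]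
    simp only [Finset.prod_inv_distrib]
    field_simp
  rw [h5] at h4
  rcases hε with rfl | rfl
  · exact ⟨1, Or.inl rfl, by simpa [monomialVec] using h4⟩
  · exact ⟨-1, Or.inr rfl, by simpa [monomialVec] using h4⟩

theorem linearIndependent_monomialVec (n : ℕ) :
    LinearIndependent ℚ (monomialVec (n := n)) := by
  rw [linearIndependent_iff']
  intro S c hc A hA
  by_contra h0
  -- At the leading state of a term B of maximal degree no other term contributes: leading states
  -- are distinct, and remainders have degree below that of B.
  obtain ⟨B, hB, hmax⟩ := Finset.exists_max_image (S.filter fun A => c A ≠ 0)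
    (fun A => deg (stateOf A)) ⟨A, by simp [hA, h0]⟩
  rw [Finset.mem_filter] at hB
  have h1 : ∀ C ∈ S, C ≠ B → (c C • monomialVec C) (stateOf B) = 0 := by
    intro C hC hCB
    by_cases hcC : c C = 0
    · simp [hcC]
    obtain ⟨ε, -, h2⟩ := monomialVec_leading C
    have h3 : (monomialVec C - Finsupp.single (stateOf C) (ε : ℚ)) (stateOf B) = 0 := by
      by_contra h4
      exact absurd (hmax C (by simp [hC, hcC])) (not_le.2 (deg_lt_of_mem_below h2 h4))
    rw [Finsupp.sub_apply, Finsupp.single_eq_of_ne (stateOf_injective.ne hCB.symm), sub_zero] at h3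
    rw [Finsupp.smul_apply, h3, smul_zero]
  have h2 := DFunLike.congr_fun hc (stateOf B)
  rw [Finsupp.finsetSum_apply, Finset.sum_eq_single_of_mem B hB.1 h1, Finsupp.smul_apply] at h2
  obtain ⟨ε, hε, h3⟩ := monomialVec_leading B
  have h4 : (monomialVec B - Finsupp.single (stateOf B) (ε : ℚ)) (stateOf B) = 0 := by
    by_contra h4
    exact lt_irrefl _ (deg_lt_of_mem_below h3 h4)
  rw [Finsupp.sub_apply, Finsupp.single_eq_same, sub_eq_zero] at h4
  rw [h4] at h2
  rcases hε with rfl | rfl <;> simp [hB.2] at h2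

theorem exists_intCast_of_mem_lattice {P : Type*} {v : Fock P} (hv : v ∈ lattice P)
    (s : State P) : ∃ m : ℤ, v s = m := by
  classical
  induction hv using Submodule.span_induction with
  | mem _ h =>
    obtain ⟨s', rfl⟩ := h
    exact ⟨if s' = s then 1 else 0, by simp [Finsupp.single_apply]⟩
  | zero => exact ⟨0, by simp⟩
  | add v w _ _ hv hw =>
    obtain ⟨a, ha⟩ := hv
    obtain ⟨b, hb⟩ := hw
    exact ⟨a + b, by simp [ha, hb]⟩
  | smul c v _ hv =>
    obtain ⟨a, ha⟩ := hv
    exact ⟨c * a, by simp [ha]⟩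

/-- Induction on degree: a basis vector is ± some `monomialVec A` minus a remainder that is both of
lower degree and integral, hence an integer combination of vectors already treated. -/
theorem lattice_le_span_monomialVec (hm : ∀ A : SuperMat n, monomial A ∈ UZ n) :
    lattice (Fin n ×ₗ Fin n) ≤ Submodule.span ℤ (Set.range (monomialVec (n := n))) := by
  have key : ∀ d : ℕ, ∀ s : State (Fin n ×ₗ Fin n), deg s = d →
      Finsupp.single s (1 : ℚ) ∈ Submodule.span ℤ (Set.range (monomialVec (n := n))) := by
    intro d
    induction d using Nat.strong_induction_on with
    | _ d ih =>
      rintro s rfl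
      obtain ⟨A, rfl⟩ := stateOf_surjective s
      obtain ⟨ε, hε, h1⟩ := monomialVec_leading A
      have hl : monomialVec A - Finsupp.single (stateOf A) (ε : ℚ) ∈ lattice (Fin n ×ₗ Fin n) :=
        sub_mem (UZ_le_comap_latticeEnd n (hm A) _ (Submodule.subset_span ⟨_, rfl⟩))
          (single_intCast_mem_lattice _ _)
      have h2 : monomialVec A - Finsupp.single (stateOf A) (ε : ℚ)
          ∈ Submodule.span ℤ (Set.range (monomialVec (n := n))) := by
        rw [← Finsupp.sum_single (monomialVec A - Finsupp.single (stateOf A) (ε : ℚ))]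
        refine sum_mem fun t ht => ?_
        obtain ⟨m, hm⟩ := exists_intCast_of_mem_lattice hl t
        have e : Finsupp.single t (m : ℚ) = m • Finsupp.single t (1 : ℚ) := by simp
        rw [hm, e]
        exact Submodule.smul_mem _ _
          (ih _ (deg_lt_of_mem_below h1 (Finsupp.mem_support_iff.1 ht)) t rfl)
      have h3 := sub_mem (Submodule.subset_span (Set.mem_range_self A)) h2
      rw [sub_sub_cancel] at h3
      rcases hε with rfl | rfl
      · simpa using h3
      · simpa [Finsupp.single_neg] using h3
  exact Submodule.span_le.2 (by rintro _ ⟨s, rfl⟩; exact key _ s rfl)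

end

/-! ### Divided powers of all root vectors, and triangular factorization -/

section

section DividedPowerCommutator

variable {R : Type*} [Ring R]

theorem mul_pow_succ_of_commutator {a b c : R} (hab : a * b = b * a + c) (hbc : Commute b c)
    (m : ℕ) : a * b ^ (m + 1) = b ^ (m + 1) * a + (m + 1) • (b ^ m * c) := by
  induction m with
  | zero => simp [hab]
  | succ m ih =>
    rw [pow_succ, ← mul_assoc, ih, add_mul, mul_assoc (b ^ (m + 1)), hab, smul_mul_assoc,
      mul_assoc (b ^ m), ← hbc.eq, ← mul_assoc (b ^ m), ← pow_succ, mul_add, ← mul_assoc,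
      succ_nsmul (b ^ (m + 1) * c) (m + 1)]
    abel

/-- When c is central for a and b, ad a acts on powers of b like the derivation c·d/db. -/
theorem iterate_commutator_pow {a b c : R} (hab : a * b = b * a + c) (hac : Commute a c)
    (hbc : Commute b c) (j m : ℕ) :
    ((LinearMap.mulLeft ℤ a - LinearMap.mulRight ℤ a) ^ j) (b ^ (m + j))
      = (m + j).descFactorial j • (b ^ m * c ^ j) := by
  induction j generalizing m with
  | zero => simp
  | succ j ih =>
    have e : m + (j + 1) = (m + 1) + j := by omega
    rw [pow_succ', Module.End.mul_apply, e, ih, map_nsmul, LinearMap.sub_apply,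
      LinearMap.mulLeft_apply, LinearMap.mulRight_apply, ← mul_assoc,
      mul_pow_succ_of_commutator hab hbc, mul_assoc, ← (hac.pow_right j).eq, add_mul, mul_assoc,
      add_sub_cancel_left, smul_mul_assoc, mul_assoc, ← pow_succ', smul_smul,
      Nat.descFactorial_succ, mul_comm]
    congr 2
    omega

theorem pow_eq_sum_of_commutator {a b c : R} (hab : a * b = b * a + c) (hac : Commute a c)
    (hbc : Commute b c) (k : ℕ) :
    k.factorial • c ^ k = ∑ m ∈ Finset.HasAntidiagonal.antidiagonal k,
      k.choose m.1 • (a ^ m.1 * b ^ k * (-a) ^ m.2) := by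
  have h1 := iterate_commutator_pow hab hac hbc k 0
  -- Left and right multiplications commute, so the binomial theorem expands the k-th power of ad a.
  have h2 : Commute (LinearMap.mulLeft ℤ a) (LinearMap.mulRight ℤ (-a)) :=
    LinearMap.commute_mulLeft_right a (-a)
  have h3 : LinearMap.mulLeft ℤ a - LinearMap.mulRight ℤ a
      = LinearMap.mulLeft ℤ a + LinearMap.mulRight ℤ (-a) := by
    ext; simp [sub_eq_add_neg]
  rw [h3, h2.add_pow', zero_add, pow_zero, one_mul, Nat.descFactorial_self,
    LinearMap.sum_apply] at h1
  rw [← h1]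
  refine Finset.sum_congr rfl fun m _ => ?_
  rw [LinearMap.smul_apply, Module.End.mul_apply, LinearMap.pow_mulLeft, LinearMap.pow_mulRight,
    LinearMap.mulRight_apply, LinearMap.mulLeft_apply, mul_assoc]

end DividedPowerCommutator

variable {n : ℕ}

/-- Dividing the expansion of (ad a)^k (b^k) = k! c^k by (k!)² gives c^(k) as the sum of the ± a^(i)
b^(k) a^(j) with i + j = k, which has integer coefficients. -/
theorem divPow_mem_of_commutator (S : Subalgebra ℤ (U n)) {a b c : U n}
    (hab : a * b = b * a + c) (hac : Commute a c) (hbc : Commute b c)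
    (ha : ∀ k, divPow a k ∈ S) (hb : ∀ k, divPow b k ∈ S) (k : ℕ) : divPow c k ∈ S := by
  have h0 : (k.factorial : ℚ) ≠ 0 := by positivity
  have e : divPow c k = ∑ m ∈ Finset.HasAntidiagonal.antidiagonal k,
      divPow a m.1 * divPow b k * ((-1) ^ m.2 * divPow a m.2) := by
    have h1 : divPow c k
        = ((k.factorial : ℚ)⁻¹ * (k.factorial : ℚ)⁻¹) • (k.factorial • c ^ k) := by
      rw [divPow, ← Nat.cast_smul_eq_nsmul ℚ, smul_smul, mul_assoc, inv_mul_cancel₀ h0, mul_one]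
    rw [h1, pow_eq_sum_of_commutator hab hac hbc, Finset.smul_sum]
    refine Finset.sum_congr rfl fun m hm => ?_
    obtain rfl := Finset.HasAntidiagonal.mem_antidiagonal.1 hm
    rw [mul_smul, inv_factorial_smul_choose_smul, neg_pow a]
    simp only [divPow, smul_mul_assoc, mul_smul_comm, smul_smul]
    congr 1
    ring
  rw [e]
  exact sum_mem fun m _ => mul_mem (mul_mem (ha _) (hb _))
    (mul_mem (pow_mem (neg_mem (one_mem _)) _) (ha _))

/-- The subalgebra contains all divided powers of `x i j` and it contains `xbar i j`. -/
def ContainsRoot (S : Subalgebra ℤ (U n)) (i j : Fin n) : Prop :=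
  (∀ k, divPow (x i j) k ∈ S) ∧ xbar i j ∈ S

/-- The even root vector is the commutator of x_ik and x_kj and commutes with both; the odd one is
the commutator of x_ik and x̄_kj. -/
theorem ContainsRoot.trans {S : Subalgebra ℤ (U n)} {i k j : Fin n} (h1 : ContainsRoot S i k)
    (h2 : ContainsRoot S k j) (hik : i ≠ k) (hkj : k ≠ j) (hij : i ≠ j) : ContainsRoot S i j := by
  refine ⟨divPow_mem_of_commutator S ?_ ?_ ?_ h1.1 h2.1, ?_⟩
  · rw [x_mul_x]; simp [hij.symm]
  · rw [Commute, SemiconjBy, x_mul_x]; simp [hik.symm, hij.symm]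
  · rw [Commute, SemiconjBy, x_mul_x]; simp [hij.symm, hkj.symm]
  · have hx : (x i k : U n) ∈ S := by simpa [divPow] using h1.1 1
    have e := x_mul_xbar i k k j
    simp only [if_true, hij.symm, if_false, sub_zero] at e
    rw [← sub_eq_iff_eq_add'.2 e]
    exact sub_mem (mul_mem hx h2.2) (mul_mem h2.2 hx)

theorem containsRoot_UZplus {i j : Fin n} (hij : i < j) : ContainsRoot (UZplus n) i j := by
  -- Induction on the height of the root: d = 0 is a simple root, and each step splits one off at
  -- column j - 1.
  obtain ⟨d, hd⟩ : ∃ d, (j : ℕ) = i + d + 1 := ⟨j - i - 1, by have := Fin.lt_def.1 hij; omega⟩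
  induction d generalizing j with
  | zero =>
    exact ⟨fun k => Algebra.subset_adjoin ⟨i, j, hd, Or.inl ⟨k, rfl⟩⟩,
      Algebra.subset_adjoin ⟨i, j, hd, Or.inr rfl⟩⟩
  | succ d ih =>
    let k : Fin n := ⟨i + d + 1, by omega⟩
    have hik : i < k := Fin.lt_def.2 (by simp only [k]; omega)
    have hkj : k < j := Fin.lt_def.2 (by simp only [k]; omega)
    have hk : (j : ℕ) = k + 1 := by simp only [k]; omega
    refine (ih hik rfl).trans ⟨fun m => ?_, ?_⟩ hik.ne hkj.ne hij.ne
    · exact Algebra.subset_adjoin ⟨k, j, hk, Or.inl ⟨m, rfl⟩⟩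
    · exact Algebra.subset_adjoin ⟨k, j, hk, Or.inr rfl⟩

theorem containsRoot_UZminus {i j : Fin n} (hij : i < j) : ContainsRoot (UZminus n) j i := by
  obtain ⟨d, hd⟩ : ∃ d, (j : ℕ) = i + d + 1 := ⟨j - i - 1, by have := Fin.lt_def.1 hij; omega⟩
  induction d generalizing j with
  | zero =>
    exact ⟨fun k => Algebra.subset_adjoin ⟨i, j, hd, Or.inl ⟨k, rfl⟩⟩,
      Algebra.subset_adjoin ⟨i, j, hd, Or.inr rfl⟩⟩
  | succ d ih =>
    let k : Fin n := ⟨i + d + 1, by omega⟩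
    have hik : i < k := Fin.lt_def.2 (by simp only [k]; omega)
    have hkj : k < j := Fin.lt_def.2 (by simp only [k]; omega)
    have hk : (j : ℕ) = k + 1 := by simp only [k]; omega
    refine ContainsRoot.trans ⟨fun m => ?_, ?_⟩ (ih hik rfl) hkj.ne' hik.ne' hij.ne'
    · exact Algebra.subset_adjoin ⟨k, j, hk, Or.inl ⟨m, rfl⟩⟩
    · exact Algebra.subset_adjoin ⟨k, j, hk, Or.inr rfl⟩

theorem ContainsRoot.rootFactor_mem {S : Subalgebra ℤ (U n)} {i j : Fin n}
    (h : ContainsRoot S i j) (A : SuperMat n) : rootFactor A i j ∈ S :=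
  mul_mem (h.1 _) (pow_mem h.2 _)

theorem list_map_prod_mem {α : Type*} (S : Subalgebra ℤ (U n)) (l : List α) (f : α → U n)
    (H : ∀ a ∈ l, f a ∈ S) : (l.map f).prod ∈ S := by
  refine Subalgebra.list_prod_mem _ fun u hu => ?_
  obtain ⟨a, ha, rfl⟩ := List.mem_map.1 hu
  exact H a ha

theorem ePlus_mem (A : SuperMat n) : ePlus A ∈ UZplus n :=
  list_map_prod_mem _ _ _ fun j _ => list_map_prod_mem _ _ _ fun k hk =>
    (containsRoot_UZplus (by simpa using hk)).rootFactor_mem A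

theorem fMinus_mem (A : SuperMat n) : fMinus A ∈ UZminus n :=
  list_map_prod_mem _ _ _ fun j _ => list_map_prod_mem _ _ _ fun k hk =>
    (containsRoot_UZminus (by simpa using hk)).rootFactor_mem A

theorem hBinom_mem (b : Fin n → ℕ) : hBinom b ∈ UZzero n :=
  list_map_prod_mem _ _ _ fun i _ => Algebra.subset_adjoin ⟨i, Or.inl ⟨b i, rfl⟩⟩

theorem hbarProd_mem (b : Fin n → Fin 2) : hbarProd b ∈ UZzero n :=
  list_map_prod_mem _ _ _ fun i _ => pow_mem (Algebra.subset_adjoin (show hbar i ∈ zeroGens n from ⟨i, Or.inr rfl⟩)) _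

theorem UZplus_le (n : ℕ) : UZplus n ≤ UZ n :=
  Algebra.adjoin_mono fun _ hu => Or.inl (Or.inl hu)

theorem UZminus_le (n : ℕ) : UZminus n ≤ UZ n :=
  Algebra.adjoin_mono fun _ hu => Or.inl (Or.inr hu)

theorem UZzero_le (n : ℕ) : UZzero n ≤ UZ n :=
  Algebra.adjoin_mono fun _ hu => Or.inr hu

theorem monomial_mem (A : SuperMat n) : monomial A ∈ UZ n :=
  mul_mem (mul_mem (mul_mem (UZminus_le n (fMinus_mem A)) (UZzero_le n (hBinom_mem _)))
    (UZzero_le n (hbarProd_mem _))) (UZplus_le n (ePlus_mem A))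

section Restrict

variable (r : Fin n → Fin n → Prop) [DecidableRel r]

/-- The pair of matrices obtained by setting the entries outside `r` to zero. -/
def restrict (A : SuperMat n) : SuperMat n :=
  (fun i j => if r i j then A.1 i j else 0, fun i j => if r i j then A.2 i j else 0)

theorem supportedOn_restrict (A : SuperMat n) : SupportedOn r (restrict r A) :=
  fun i j h => by simp [restrict, h]

variable {r}

theorem SupportedOn.restrict_eq {A : SuperMat n} (hA : SupportedOn r A) : restrict r A = A := by
  refine Prod.ext (funext fun i => funext fun j => ?_) (funext fun i => funext fun j => ?_) <;>
    by_cases h : r i j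
  · simp [restrict, h]
  · simp [restrict, h, (hA i j h).1]
  · simp [restrict, h]
  · simp [restrict, h, (hA i j h).2]

theorem rootFactor_restrict (A : SuperMat n) (i j : Fin n) :
    rootFactor (restrict r A) i j = if r i j then rootFactor A i j else 1 := by
  by_cases h : r i j <;> simp [rootFactor, restrict, h, divPow]

theorem fMinus_restrict (A : SuperMat n) (h : ∀ i j, j < i → r i j) :
    fMinus (restrict r A) = fMinus A := by
  unfold fMinus colProd
  refine congrArg _ (List.map_congr_left fun j _ => congrArg _ (List.map_congr_left fun k hk => ?_))
  rw [rootFactor_restrict, if_pos (h _ _ (by simpa using hk))]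

theorem ePlus_restrict (A : SuperMat n) (h : ∀ i j, i < j → r i j) :
    ePlus (restrict r A) = ePlus A := by
  unfold ePlus rowProd
  refine congrArg _ (List.map_congr_left fun j _ => congrArg _ (List.map_congr_left fun k hk => ?_))
  rw [rootFactor_restrict, if_pos (h _ _ (by simpa using hk))]

theorem fMinus_restrict_eq_one (A : SuperMat n) (h : ∀ i j, j < i → ¬ r i j) :
    fMinus (restrict r A) = 1 := by
  refine List.prod_eq_one fun u hu => ?_
  obtain ⟨j, -, rfl⟩ := List.mem_map.1 hu
  refine List.prod_eq_one fun u hu => ?_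
  obtain ⟨k, hk, rfl⟩ := List.mem_map.1 hu
  rw [rootFactor_restrict, if_neg (h _ _ (by simpa using hk))]

theorem ePlus_restrict_eq_one (A : SuperMat n) (h : ∀ i j, i < j → ¬ r i j) :
    ePlus (restrict r A) = 1 := by
  refine List.prod_eq_one fun u hu => ?_
  obtain ⟨j, -, rfl⟩ := List.mem_map.1 hu
  refine List.prod_eq_one fun u hu => ?_
  obtain ⟨k, hk, rfl⟩ := List.mem_map.1 hu
  rw [rootFactor_restrict, if_neg (h _ _ (by simpa using hk))]

theorem hBinom_zero : (hBinom (fun _ => 0) : U n) = 1 := by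
  simp [hBinom, binom]

theorem hbarProd_zero : (hbarProd (fun _ => 0) : U n) = 1 := by
  simp [hbarProd]

end Restrict

theorem monomial_restrict_gt (A : SuperMat n) :
    monomial (restrict (fun i j => j < i) A) = fMinus A := by
  rw [monomial, fMinus_restrict A fun i j h => h, ePlus_restrict_eq_one A fun i j h => h.not_gt]
  simp [restrict, hBinom_zero, hbarProd_zero]

theorem monomial_restrict_eq (A : SuperMat n) :
    monomial (restrict (fun i j => i = j) A)
      = hBinom (fun i => A.1 i i) * hbarProd (fun i => A.2 i i) := by
  rw [monomial, fMinus_restrict_eq_one A fun i j h => h.ne',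
    ePlus_restrict_eq_one A fun i j h => h.ne]
  simp [restrict]

theorem monomial_restrict_lt (A : SuperMat n) :
    monomial (restrict (fun i j => i < j) A) = ePlus A := by
  rw [monomial, ePlus_restrict A fun i j h => h, fMinus_restrict_eq_one A fun i j h => h.not_gt]
  simp [restrict, hBinom_zero, hbarProd_zero]

theorem monomial_eq_mul (A : SuperMat n) :
    monomial A = monomial (restrict (fun i j => j < i) A)
      * monomial (restrict (fun i j => i = j) A) * monomial (restrict (fun i j => i < j) A) := by
  rw [monomial_restrict_gt, monomial_restrict_eq, monomial_restrict_lt, monomial, mul_assoc,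
    mul_assoc, mul_assoc, mul_assoc]

/-- Decomposition of a pair of matrices into its strictly lower, diagonal and strictly upper
triangular parts. -/
def triangularEquiv (n : ℕ) : SuperMat n ≃
    ({A : SuperMat n // SupportedOn (fun i j => j < i) A}
      × {A : SuperMat n // SupportedOn (fun i j => i = j) A})
      × {A : SuperMat n // SupportedOn (fun i j => i < j) A} where
  toFun A := ((⟨_, supportedOn_restrict _ A⟩, ⟨_, supportedOn_restrict _ A⟩),
    ⟨_, supportedOn_restrict _ A⟩)
  invFun B :=
    (fun i j => if j < i then B.1.1.1.1 i j else if i = j then B.1.2.1.1 i j else B.2.1.1 i j,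
      fun i j => if j < i then B.1.1.1.2 i j else if i = j then B.1.2.1.2 i j else B.2.1.2 i j)
  left_inv A := by
    refine Prod.ext (funext fun i => funext fun j => ?_) (funext fun i => funext fun j => ?_) <;>
      rcases lt_trichotomy i j with h | h | h
    · simp [restrict, h, h.not_gt, h.ne]
    · simp [restrict, h]
    · simp [restrict, h]
    · simp [restrict, h, h.not_gt, h.ne]
    · simp [restrict, h]
    · simp [restrict, h]
  right_inv := by
    rintro ⟨⟨⟨A, hA⟩, ⟨B, hB⟩⟩, ⟨C, hC⟩⟩
    refine Prod.ext (Prod.ext (Subtype.ext ?_) (Subtype.ext ?_)) (Subtype.ext ?_)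
    · refine Eq.trans ?_ hA.restrict_eq
      refine Prod.ext (funext fun i => funext fun j => ?_) (funext fun i => funext fun j => ?_) <;>
        by_cases h : j < i <;> simp [restrict, h]
    · refine Eq.trans ?_ hB.restrict_eq
      refine Prod.ext (funext fun i => funext fun j => ?_) (funext fun i => funext fun j => ?_) <;>
        by_cases h : i = j <;> simp [restrict, h]
    · refine Eq.trans ?_ hC.restrict_eq
      refine Prod.ext (funext fun i => funext fun j => ?_) (funext fun i => funext fun j => ?_) <;>
        by_cases h : i < j
      · simp [restrict, h, h.not_gt, h.ne]
      · simp [restrict, h]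
      · simp [restrict, h, h.not_gt, h.ne]
      · simp [restrict, h]

end

/-! ### Descent from ℚ to ℤ, and assembly of the bases -/

section

variable {n : ℕ} {r : Fin n → Fin n → Prop}

theorem exists_mem_shorter_of_mem_adjoin {S : Set (U n)} (hS : ∀ u ∈ S, ∃ d, u ∈ shorter r d)
    {u : U n} (hu : u ∈ Algebra.adjoin ℤ S) : ∃ d, u ∈ shorter r d := by
  induction hu using Algebra.adjoin_induction with
  | mem u hu => exact hS u hu
  | algebraMap m =>
    refine ⟨1, ?_⟩
    have e : algebraMap ℤ (U n) m = (m : ℚ) • word [] := by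
      simp [word, Algebra.smul_def]
    rw [e]
    exact Submodule.smul_mem _ _ (word_mem_shorter (by simp [Inside]) (by simp))
  | add u v _ _ hu hv =>
    obtain ⟨a, ha⟩ := hu
    obtain ⟨b, hb⟩ := hv
    exact ⟨a + b, add_mem (shorter_mono (by omega) ha) (shorter_mono (by omega) hb)⟩
  | mul u v _ _ hu hv =>
    obtain ⟨a, ha⟩ := hu
    obtain ⟨b, hb⟩ := hv
    exact ⟨a + b, mul_mem_shorter ha hb (by omega)⟩

theorem HasLeadingWord.exists_mem_shorter {u : U n} {c : ℚ} {l : List (Label n)}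
    (H : HasLeadingWord r u c l) : ∃ d, u ∈ shorter r d := by
  refine ⟨l.length + 1, ?_⟩
  have := add_mem (shorter_mono (Nat.le_succ _) H.2)
    (Submodule.smul_mem _ c (word_mem_shorter H.1 (Nat.lt_succ_self _)))
  rwa [sub_add_cancel] at this

theorem exists_mem_shorter_plusGens (hr : ∀ i j : Fin n, i < j → r i j) {u : U n}
    (hu : u ∈ plusGens n) : ∃ d, u ∈ shorter r d := by
  obtain ⟨i, j, hij, ⟨k, rfl⟩ | rfl⟩ := hu
  · exact (HasLeadingWord.divPow (Or.inl (hr i j (Fin.lt_def.2 (by omega))))).exists_mem_shorter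
  · have := HasLeadingWord.xbar_pow (k := 1) (Or.inl (hr i j (Fin.lt_def.2 (by omega))))
    rw [pow_one] at this
    exact this.exists_mem_shorter

theorem exists_mem_shorter_minusGens (hr : ∀ i j : Fin n, j < i → r i j) {u : U n}
    (hu : u ∈ minusGens n) : ∃ d, u ∈ shorter r d := by
  obtain ⟨i, j, hij, ⟨k, rfl⟩ | rfl⟩ := hu
  · exact (HasLeadingWord.divPow (Or.inl (hr j i (Fin.lt_def.2 (by omega))))).exists_mem_shorter
  · have := HasLeadingWord.xbar_pow (k := 1) (Or.inl (hr j i (Fin.lt_def.2 (by omega))))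
    rw [pow_one] at this
    exact this.exists_mem_shorter

theorem exists_mem_shorter_zeroGens (hr : ∀ i : Fin n, r i i) {u : U n}
    (hu : u ∈ zeroGens n) : ∃ d, u ∈ shorter r d := by
  obtain ⟨i, ⟨k, rfl⟩ | rfl⟩ := hu
  · exact (HasLeadingWord.binom (Or.inl (hr i))).exists_mem_shorter
  · have := HasLeadingWord.xbar_pow (k := 1) (Or.inl (hr i))
    rw [pow_one] at this
    exact this.exists_mem_shorter

theorem mem_span_monomial_of_mem_adjoin (hr : ∀ i j k, r i j → r j k → r i k) {S : Set (U n)}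
    (hS : ∀ u ∈ S, ∃ d, u ∈ shorter r d) {u : U n} (hu : u ∈ Algebra.adjoin ℤ S) :
    u ∈ Submodule.span ℚ (monomial '' {A | SupportedOn r A}) := by
  obtain ⟨d, hd⟩ := exists_mem_shorter_of_mem_adjoin hS hu
  exact shorter_le_span_monomial hr d hd

theorem UZplus_subset_span (u : U n) (hu : u ∈ UZplus n) :
    u ∈ Submodule.span ℚ (monomial '' {A : SuperMat n | SupportedOn (fun i j => i < j) A}) :=
by
  have hS : ∀ v ∈ plusGens n, ∃ d, v ∈ shorter (fun i j : Fin n => i < j) d :=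
    fun v hv => exists_mem_shorter_plusGens (r := fun i j => i < j) (fun _ _ h => h) hv
  have hr : ∀ i j k : Fin n, i < j → j < k → i < k := fun _ _ _ => lt_trans
  exact mem_span_monomial_of_mem_adjoin hr hS hu

theorem UZminus_subset_span (u : U n) (hu : u ∈ UZminus n) :
    u ∈ Submodule.span ℚ (monomial '' {A : SuperMat n | SupportedOn (fun i j => j < i) A}) :=
by
  have hS : ∀ v ∈ minusGens n, ∃ d, v ∈ shorter (fun i j : Fin n => j < i) d :=
    fun v hv => exists_mem_shorter_minusGens (r := fun i j => j < i) (fun _ _ h => h) hv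
  have hr : ∀ i j k : Fin n, j < i → k < j → k < i := fun _ _ _ h h' => lt_trans h' h
  exact mem_span_monomial_of_mem_adjoin hr hS hu

theorem UZzero_subset_span (u : U n) (hu : u ∈ UZzero n) :
    u ∈ Submodule.span ℚ (monomial '' {A : SuperMat n | SupportedOn (fun i j => i = j) A}) :=
  mem_span_monomial_of_mem_adjoin (fun _ _ _ h h' => h.trans h')
    (fun _ hv => exists_mem_shorter_zeroGens (fun _ => rfl) hv) hu

theorem UZ_subset_span : ∀ u ∈ UZ n, u ∈ Submodule.span ℚ (Set.range (monomial (n := n))) := by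
  intro u hu
  obtain ⟨d, hd⟩ := exists_mem_shorter_of_mem_adjoin (r := fun _ _ => True) (by
    rintro u ((hu | hu) | hu)
    · exact exists_mem_shorter_plusGens (fun _ _ _ => trivial) hu
    · exact exists_mem_shorter_minusGens (fun _ _ _ => trivial) hu
    · exact exists_mem_shorter_zeroGens (fun _ => trivial) hu) hu
  exact Submodule.span_mono (Set.image_subset_range _ _)
    (shorter_le_span_monomial (fun _ _ _ _ _ => trivial) d hd)

/-- Evaluation of the action of `U(𝔮(n))` on the vacuum. -/
def evalVacuum (n : ℕ) : U n →ₗ[ℚ] Fock (Fin n ×ₗ Fin n) :=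
  LinearMap.applyₗ (vacuum n) ∘ₗ (fockRep n).toLinearMap

theorem linearIndependent_monomial (n : ℕ) : LinearIndependent ℚ (monomial (n := n)) :=
  LinearIndependent.of_comp (evalVacuum n) (linearIndependent_monomialVec n)

/-- The image of u on the vacuum lies in the lattice, so it equals that of some integer combination
v of monomials. Both u and v lie in the ℚ-span of the monomials, which meets the kernel of
evaluation trivially, so u = v. -/
theorem UZ_le_span_int : ∀ u ∈ UZ n, u ∈ Submodule.span ℤ (Set.range (monomial (n := n))) := by
  intro u hu
  have h1 : evalVacuum n u ∈ Submodule.span ℤ (Set.range (monomialVec (n := n))) :=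
    lattice_le_span_monomialVec monomial_mem
      (UZ_le_comap_latticeEnd n hu _ (Submodule.subset_span ⟨_, rfl⟩))
  have e : Set.range (monomialVec (n := n))
      = ((evalVacuum n).restrictScalars ℤ) '' Set.range monomial := by
    rw [← Set.range_comp]; rfl
  rw [e, ← Submodule.map_span] at h1
  obtain ⟨v, hv, hvu⟩ := h1
  have hv' : v ∈ Submodule.span ℚ (Set.range (monomial (n := n))) :=
    Submodule.span_le_restrictScalars ℤ ℚ _ hv
  have hd := Submodule.range_ker_disjoint (f := evalVacuum n) (v := monomial)
    (linearIndependent_monomialVec n)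
  have h0 : v - u = 0 := by
    refine Submodule.disjoint_def.1 hd _ (sub_mem hv' (UZ_subset_span u hu)) ?_
    rw [LinearMap.mem_ker, map_sub, sub_eq_zero]
    exact hvu
  rwa [← sub_eq_zero.1 h0]

/-- By independence over ℚ the integral and the rational expansions coincide, so the integral one
inherits the support condition. -/
theorem mem_span_int_of_mem_span_rat {M ι : Type*} [AddCommGroup M] [Module ℚ M] {v : ι → M}
    (hv : LinearIndependent ℚ v) {s : Set ι} {u : M} (h1 : u ∈ Submodule.span ℤ (Set.range v))
    (h2 : u ∈ Submodule.span ℚ (v '' s)) :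
    u ∈ Submodule.span ℤ (Set.range fun a : s => v a) := by
  obtain ⟨c, rfl⟩ := Finsupp.mem_span_range_iff_exists_finsupp.1 h1
  obtain ⟨d, hd, hdc⟩ := (Finsupp.mem_span_image_iff_linearCombination ℚ).1 h2
  have e : d = c.mapRange (Int.cast : ℤ → ℚ) Int.cast_zero := by
    apply hv
    rw [hdc, Finsupp.linearCombination_apply, Finsupp.sum_mapRange_index (by simp)]
    simp only [Int.cast_smul_eq_zsmul]
  refine sum_mem fun a ha => Submodule.smul_mem _ _ (Submodule.subset_span ⟨⟨a, ?_⟩, rfl⟩)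
  refine (Finsupp.mem_supported ℚ d).1 hd ?_
  rw [Finset.mem_coe, Finsupp.mem_support_iff, e, Finsupp.mapRange_apply]
  exact_mod_cast Finsupp.mem_support_iff.1 ha

theorem exists_basis_subalgebra {R ι : Type*} [Ring R] (S : Subalgebra ℤ R) (v : ι → R)
    (hv : LinearIndependent ℤ v) (h1 : ∀ i, v i ∈ S)
    (h2 : ∀ u ∈ S, u ∈ Submodule.span ℤ (Set.range v)) :
    ∃ β : Module.Basis ι ℤ S, ∀ i, (β i : R) = v i := by
  have e : Submodule.span ℤ (Set.range v) = Subalgebra.toSubmodule S :=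
    le_antisymm (Submodule.span_le.2 (by rintro _ ⟨i, rfl⟩; exact h1 i)) h2
  refine ⟨(Module.Basis.span hv).map ((LinearEquiv.ofEq _ _ e).trans S.toSubmoduleEquiv), ?_⟩
  intro i
  exact congrArg Subtype.val (Module.Basis.span_apply hv i)

theorem exists_basis_of_supportedOn (S : Subalgebra ℤ (U n)) (hS : S ≤ UZ n)
    (h1 : ∀ A, SupportedOn r A → monomial A ∈ S)
    (h2 : ∀ u ∈ S, u ∈ Submodule.span ℚ (monomial '' {A | SupportedOn r A})) :
    ∃ β : Module.Basis {A : SuperMat n // SupportedOn r A} ℤ S, ∀ A, (β A : U n) = monomial A.1 :=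
  exists_basis_subalgebra S _
    (((linearIndependent_monomial n).restrict_scalars' ℤ).comp _ Subtype.val_injective)
    (fun A => h1 A.1 A.2)
    fun u hu => mem_span_int_of_mem_span_rat (linearIndependent_monomial n)
      (UZ_le_span_int u (hS hu)) (h2 u hu)

/-- The equivalence is defined by matching bases. Composed with the inclusion into the ambient ring
it agrees with multiplication on the tensor basis, hence everywhere. -/
theorem exists_equiv_of_bases {K R I J L ι : Type*} [CommRing K] [Ring R] [Algebra K R]
    {S T W V : Subalgebra K R} (a : Module.Basis I K S) (b : Module.Basis J K T)
    (c : Module.Basis L K W) (β : Module.Basis ι K V) (e : ι ≃ (I × J) × L)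
    (H : ∀ i, (β i : R) = (a (e i).1.1 : R) * b (e i).1.2 * c (e i).2) :
    ∃ φ : ((S ⊗[K] T) ⊗[K] W) ≃ₗ[K] V, ∀ (s : S) (t : T) (w : W),
      (φ ((s ⊗ₜ[K] t) ⊗ₜ[K] w) : R) = (s : R) * t * w := by
  let B := (a.tensorProduct b).tensorProduct c
  let φ := B.equiv β e.symm
  let μ : ((S ⊗[K] T) ⊗[K] W) →ₗ[K] R := LinearMap.mul' K R ∘ₗ TensorProduct.map
    (LinearMap.mul' K R ∘ₗ TensorProduct.map S.val.toLinearMap T.val.toLinearMap)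
    W.val.toLinearMap
  have hμ : ∀ (s : S) (t : T) (w : W), μ ((s ⊗ₜ[K] t) ⊗ₜ[K] w) = (s : R) * t * w :=
    fun s t w => by simp [μ]
  have hφ : V.val.toLinearMap ∘ₗ φ.toLinearMap = μ := by
    refine B.ext fun i => ?_
    obtain ⟨i, rfl⟩ := e.surjective i
    have e1 : φ (B (e i)) = β i := by simp [φ]
    have e2 : B (e i) = (a (e i).1.1 ⊗ₜ[K] b (e i).1.2) ⊗ₜ[K] c (e i).2 := by
      simp only [B, Module.Basis.tensorProduct_apply']
    rw [LinearMap.comp_apply, LinearEquiv.coe_coe, e1, e2, hμ]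
    exact H i
  exact ⟨φ, fun s t w => (LinearMap.congr_fun hφ _).trans (hμ s t w)⟩

end

end

end Queer

theorem proposition3p3 (n : ℕ) :
    (∃ φ : ((Queer.UZminus n ⊗[ℤ] Queer.UZzero n) ⊗[ℤ] Queer.UZplus n) ≃ₗ[ℤ] Queer.UZ n,
      ∀ (a : Queer.UZminus n) (b : Queer.UZzero n) (c : Queer.UZplus n),
        (φ ((a ⊗ₜ[ℤ] b) ⊗ₜ[ℤ] c) : Queer.U n) = (a : Queer.U n) * b * c) ∧
    (∃ β : Module.Basis (Queer.SuperMat n) ℤ (Queer.UZ n),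
      ∀ A : Queer.SuperMat n, (β A : Queer.U n) = Queer.monomial A) := by
  open Queer in
  obtain ⟨β, hβ⟩ := exists_basis_subalgebra (UZ n) monomial
    ((linearIndependent_monomial n).restrict_scalars' ℤ) monomial_mem UZ_le_span_int
  obtain ⟨βm, hm⟩ := exists_basis_of_supportedOn (UZminus n) (UZminus_le n)
    (fun A hA => by
      rw [← hA.restrict_eq, monomial_restrict_gt]; exact fMinus_mem A) UZminus_subset_span
  obtain ⟨βz, hz⟩ := exists_basis_of_supportedOn (UZzero n) (UZzero_le n)
    (fun A hA => by
      rw [← hA.restrict_eq, monomial_restrict_eq]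
      exact mul_mem (hBinom_mem _) (hbarProd_mem _)) UZzero_subset_span
  obtain ⟨βp, hp⟩ := exists_basis_of_supportedOn (UZplus n) (UZplus_le n)
    (fun A hA => by
      rw [← hA.restrict_eq, monomial_restrict_lt]; exact ePlus_mem A) UZplus_subset_span
  refine ⟨?_, β, hβ⟩
  refine exists_equiv_of_bases βm βz βp β (triangularEquiv n) fun A => ?_
  rw [hm, hz, hp]
  exact (hβ A).trans (monomial_eq_mul A)
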